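/- Let $k$ be an algebraically closed field. A *(cone over a) rational normal scroll with vertex of dimension $h\ge -1$* in $\mathbb P^s_k=\mathbb P(k^{s+1})$ is a set of the following form: for some $l\ge 1$, $d_1,\dots,d_l\ge 1$ and a decomposition $k^{s+1}=V_1\oplus\dots\oplus V_l\oplus W$ with $\dim V_i=d_i+1$ and $\dim W=h+1$, choose rational normal curves $\nu_i:\mathbb P^1\to\mathbb P(V_i)=\mathbb P^{d_i}$, $(s:t)\mapsto(s^{d_i}:s^{d_i-1}t:\dots:t^{d_i})$ (with respect to bases of the $V_i$), and take the union over $q\in\mathbb P^1$ of the linear subspaces spanned by $\nu_1(q),\dots,\nu_l(q)$ and $\mathbb P(W)$. The vertex is $\mathbb P(W)=\mathbb P^h$, with $\dim\emptyset=-1$. (So $\mathbb P^s$ itself, $s\ge1$, is regarded as a cone over $\mathbb P^1$ with vertex of dimension $s-2$.) For a projective variety $X\subset\mathbb P^r_k$ let $A_X=S/I_X$, $S=k[x_0,\dots,x_r]$, be its homogeneous coordinate ring. Its arithmetic depth is the depth of $A_X$ with respect to $S_+=(x_0,\dots,x_r)$. $X$ is of almost minimal degree if it is irreducible, non-degenerate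 and $\deg X=r-\dim X+2$. **Theorem 1.4 (Theorem 8.3 and Corollary 8.4).** Let $\tilde X\subset\mathbb P^{r+1}_k$ be a (cone over a) rational normal scroll whose vertex has dimension $h$, let $p\in\mathbb P^{r+1}_k\setminus\tilde X$, let $\varrho:\mathbb P^{r+1}_k\setminus\{p\}\to\mathbb P^r_k$ be a linear projection from $p$, and let $X=\varrho(\tilde X)$. (a) If $\dim\tilde X<r$ (that is, $\tilde X$ is not a hypersurface), or if $X$ is of almost minimal degree, then there is a (cone over a) rational normal scroll $Y\subset\mathbb P^r_k$, with vertex of some dimension $l$, such that $X\subset Y$, $\dim Y=\dim\tilde X+1=\dim X+1$ (so $X$ has codimension $1$ in $Y$) and $h\le l\le h+3$. (b) If $X$ is of almost minimal degree, then its arithmetic depth $t$ satisfies $t\le h+5$. -/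

import Mathlib

noncomputable section

open scoped LinearAlgebra.Projectivization

namespace AlmostMinimalDegree

variable {k : Type*} [Field k]

/-! Projective sets, their homogeneous coordinate rings, dimension, degree, arithmetic depth -/

/-- Projective `r`-space over `k`, with homogeneous coordinates `x_0, …, x_r`. -/
abbrev PSpace (k : Type*) [Field k] (r : ℕ) : Type _ := ℙ k (Fin (r + 1) → k)

/-- The polynomial ring `S = k[x_0, …, x_r]`. -/
abbrev CoordPoly (k : Type*) [Field k] (r : ℕ) : Type _ := MvPolynomial (Fin (r + 1)) k

/-- The affine cone over `X ⊆ ℙ^r`: the union of the lines in `k^{r+1}` which are points of `X`. -/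
def affineCone {r : ℕ} (X : Set (PSpace k r)) : Set (Fin (r + 1) → k) :=
  {v | ∃ x ∈ X, v ∈ x.submodule}

/-- The vanishing ideal `I_X ⊆ S` of `X ⊆ ℙ^r`: all polynomials that vanish on the affine cone. -/
def projIdeal {r : ℕ} (X : Set (PSpace k r)) : Ideal (CoordPoly k r) :=
  MvPolynomial.vanishingIdeal k (affineCone X)

/-- The homogeneous coordinate ring `A_X = S / I_X`. -/
abbrev coordRing {r : ℕ} (X : Set (PSpace k r)) : Type _ := CoordPoly k r ⧸ projIdeal X

/-- `dim X = dim A_X - 1`, where `dim A_X` is the Krull dimension; `dim ∅ = -1`. (The Krull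
dimension of `A_X` is at most `r + 1`, and it is `⊥` only for the zero ring, i.e. for `X = ∅`.) -/
def projDim {r : ℕ} (X : Set (PSpace k r)) : ℤ :=
  (((ringKrullDim (coordRing X)).unbotD 0).toNat : ℤ) - 1

/-- The Hilbert function `n ↦ dim_k (A_X)_n`. -/
def hilbertFn {r : ℕ} (X : Set (PSpace k r)) (n : ℕ) : ℕ :=
  Module.finrank k
    ((MvPolynomial.homogeneousSubmodule (Fin (r + 1)) k n).map
      (Ideal.Quotient.mkₐ k (projIdeal X)).toLinearMap)

/-- `X` has degree `e`: the Hilbert polynomial `P` of `X` has leading coefficient `e / (deg P)!`. -/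
def HasDegree {r : ℕ} (X : Set (PSpace k r)) (e : ℤ) : Prop :=
  ∃ P : Polynomial ℚ,
    (∀ᶠ n : ℕ in Filter.atTop, P.eval (n : ℚ) = (hilbertFn X n : ℚ)) ∧
    (P.natDegree.factorial : ℚ) * P.leadingCoeff = (e : ℚ)

/-- `X` is an irreducible (Zariski closed) projective variety in `ℙ^r`. -/
def IsProjVariety {r : ℕ} (X : Set (PSpace k r)) : Prop :=
  (projIdeal X).IsPrime ∧
    ∀ x : PSpace k r, (∀ v ∈ x.submodule, ∀ F ∈ projIdeal X, MvPolynomial.eval v F = 0) → x ∈ X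

/-- `X` is not contained in a hyperplane of `ℙ^r`. -/
def IsNondegenerate {r : ℕ} (X : Set (PSpace k r)) : Prop :=
  ∀ f : (Fin (r + 1) → k) →ₗ[k] k, (∀ x ∈ X, x.submodule ≤ LinearMap.ker f) → f = 0

/-- `X ⊆ ℙ^r` is a variety of almost minimal degree: irreducible, non-degenerate and
`deg X = codim X + 2`. -/
def IsAlmostMinimalDegree {r : ℕ} (X : Set (PSpace k r)) : Prop :=
  IsProjVariety X ∧ IsNondegenerate X ∧ HasDegree X ((r : ℤ) - projDim X + 2)

/-- The depth of the `R`-module `M` with respect to the ideal `I`: the supremum of the lengths of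
the `M`-regular sequences of elements of `I`. -/
def depthAlong {R : Type*} [CommRing R] (I : Ideal R) (M : Type*) [AddCommGroup M] [Module R M] :
    ℕ∞ :=
  ⨆ rs : {rs : List R // (∀ a ∈ rs, a ∈ I) ∧ RingTheory.Sequence.IsRegular M rs},
    (rs.1.length : ℕ∞)

/-- The arithmetic depth of `X ⊆ ℙ^r`: the depth of `A_X` with respect to the irrelevant ideal
`S_+ = (x_0, …, x_r)`. -/
def arithmeticDepth {r : ℕ} (X : Set (PSpace k r)) : ℕ∞ :=
  depthAlong (Ideal.span (Set.range (MvPolynomial.X : Fin (r + 1) → CoordPoly k r))) (coordRing X)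

/-! (Cones over) rational normal scrolls

Let `d_1, …, d_l ≥ 1` and let `V = V_1 ⊕ ⋯ ⊕ V_l ⊕ W` with `dim V_i = d_i + 1`, `dim W = v`, where
all summands come with a basis (so we are given a basis of `V` indexed as below). -/

section Scroll

variable {V : Type*} [AddCommGroup V] [Module k V] {l v : ℕ} {d : Fin l → ℕ}

/-- A vector representing the point `(s^d : s^{d-1} t : ⋯ : t^d)`, `q = (s, t)`, `d = d_i`, of the
rational normal curve in the `i`-th subspace `ℙ(V_i) = ℙ^{d_i}`. -/
def curvePoint (b : Module.Basis ((Σ i : Fin l, Fin (d i + 1)) ⊕ Fin v) k V) (i : Fin l)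
    (q : Fin 2 → k) : V :=
  ∑ j : Fin (d i + 1), (q 0 ^ (d i - (j : ℕ)) * q 1 ^ (j : ℕ)) • b (Sum.inl ⟨i, j⟩)

/-- The linear subspace `W` of dimension `v`; `ℙ(W) = ℙ^{v-1}` is the vertex of the cone. -/
def vertexSpace (b : Module.Basis ((Σ i : Fin l, Fin (d i + 1)) ⊕ Fin v) k V) : Submodule k V :=
  Submodule.span k (Set.range fun j : Fin v => b (Sum.inr j))

/-- The fibre over `q`: spanned by the `l` corresponding points on the rational normal curves and
by the vertex. -/
def rulingSpace (b : Module.Basis ((Σ i : Fin l, Fin (d i + 1)) ⊕ Fin v) k V) (q : Fin 2 → k) :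
    Submodule k V :=
  Submodule.span k (Set.range fun i : Fin l => curvePoint b i q) ⊔ vertexSpace b

/-- The cone with vertex `ℙ(W)` over the rational normal `l`-fold scroll of type `(d_1, …, d_l)`:
the union of the linear spaces spanned by corresponding points of the rational normal curves and
the vertex. For `v = 0` this is the scroll itself. -/
def scrollCone (b : Module.Basis ((Σ i : Fin l, Fin (d i + 1)) ⊕ Fin v) k V) : Set (ℙ k V) :=
  {x | ∃ q : Fin 2 → k, q ≠ 0 ∧ x.submodule ≤ rulingSpace b q}

end Scroll

/-- `X ⊆ ℙ^r` is a (cone over a) rational normal scroll whose vertex is a linear subspace of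
dimension `h` (with `h = -1` if and only if the vertex is empty, i.e. `X` is a rational normal
scroll). The choice of the basis is the choice of homogeneous coordinates. -/
def IsScrollCone {r : ℕ} (X : Set (PSpace k r)) (h : ℤ) : Prop :=
  ∃ (l v : ℕ) (d : Fin l → ℕ)
    (b : Module.Basis ((Σ i : Fin l, Fin (d i + 1)) ⊕ Fin v) k (Fin (r + 1) → k)),
    1 ≤ l ∧ (∀ i, 1 ≤ d i) ∧ X = scrollCone b ∧
      h = (Module.finrank k (vertexSpace b) : ℤ) - 1

/-- The image of `X ⊆ ℙ^s` under the linear projection `ℙ^s ⇢ ℙ^r` induced by the linear map `π`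
(to be used for `X` disjoint from the centre `ℙ(ker π)`). -/
def projImage {s r : ℕ} (π : (Fin (s + 1) → k) →ₗ[k] (Fin (r + 1) → k)) (X : Set (PSpace k s)) :
    Set (PSpace k r) :=
  {y | ∃ x ∈ X, y.submodule = x.submodule.map π}

end AlmostMinimalDegree

end

noncomputable section

open scoped LinearAlgebra.Projectivization

/-! Let `A`, `B` be the two rows of the matrix of linear forms defining the scroll, seen as linear
maps from `V = k^{r+2}` to `U = k^D`, `D = ∑ d i`. The scroll is the union over `q` of the kernels
of `q₁A - q₀B`, and this pencil is surjective for every `q ≠ 0`. Conversely, by Kronecker's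
classification, the locus of a surjective pencil with nonzero target is a cone over a scroll with
vertex `ker A ∩ ker B` (`PencilSurjective.exists_scrollBasis`).

A point `p` is off the scroll exactly when `A p` and `B p` are independent. Dividing `V` by `p` and
`U` by these two vectors leaves a surjective pencil on `k^{r+1}`; its locus is `Y`, which contains
`X`. The dimension of `Y` is read off from the ranks. That of `X` is that of the scroll, because the
coordinate `ζ` along `p` is a root of a monic quadratic polynomial, a `2 × 2` minor of the matrix.
The preimage of the vertex of `Y` consists of the `w` with `A w`, `B w` in the plane spanned by `A
p`, `B p`: at most `2 + 2` dimensions more than the old vertex, one of which is `p` itself. The new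
target is nonzero iff `D ≥ 3`; for `D = 2` the image is all of `ℙ^r`, of degree one.

For the depth, let `K` be the linear space of the vertex of `Y`. Linear forms vanishing on `K`
multiply `ζ` into `A_X` (minors again), whereas `ζ` is not in `A_X`, even locally at the origin,
because the scroll spans its ambient space. So the ideal generated by these forms has no regular
sequence of length two at the origin (`length_le_of_conductor`). The irrelevant ideal needs only
`dim K ≤ v + 3` more generators, and each raises the depth by at most one
(`HasRegularSeq.of_sup_span_singleton`). The bound is `v + 4 = h + 5`. -/

namespace AlmostMinimalDegree

/-! ### Regular sequences and a depth bound from a conductor. -/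

section Depth

open RingTheory.Sequence Pointwise

universe u v

variable {R : Type u} [CommRing R]

/-- The ideal `I` contains a weakly `M`-regular sequence of length `n`. -/
def HasRegularSeq (I : Ideal R) (M : Type v) [AddCommGroup M] [Module R M] (n : ℕ) : Prop :=
  ∃ rs : List R, rs.length = n ∧ (∀ a ∈ rs, a ∈ I) ∧ IsWeaklyRegular M rs

lemma hasRegularSeq_zero (I : Ideal R) (M : Type v) [AddCommGroup M] [Module R M] :
    HasRegularSeq I M 0 := ⟨[], by simp⟩

lemma hasRegularSeq_succ {I : Ideal R} {M : Type v} [AddCommGroup M] [Module R M] {n : ℕ} :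
    HasRegularSeq I M (n + 1) ↔
      ∃ x ∈ I, IsSMulRegular M x ∧ HasRegularSeq I (QuotSMulTop x M) n := by
  constructor
  · rintro ⟨_ | ⟨x, rs⟩, hl, hI, hr⟩
    · simp at hl
    · rw [isWeaklyRegular_cons_iff] at hr
      exact ⟨x, hI x (by simp), hr.1, rs, by simpa using hl,
        fun a ha => hI a (by simp [ha]), hr.2⟩
  · rintro ⟨x, hx, hr, rs, hl, hI, hw⟩
    refine ⟨x :: rs, by simp [hl], ?_, (isWeaklyRegular_cons_iff M x rs).2 ⟨hr, hw⟩⟩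
    simpa using ⟨hx, hI⟩

lemma HasRegularSeq.congr {I : Ideal R} {M N : Type v} [AddCommGroup M] [Module R M]
    [AddCommGroup N] [Module R N] (e : M ≃ₗ[R] N) {n : ℕ} (h : HasRegularSeq I M n) :
    HasRegularSeq I N n := by
  obtain ⟨rs, hl, hI, hr⟩ := h
  exact ⟨rs, hl, hI, (e.isWeaklyRegular_congr rs).1 hr⟩

lemma HasRegularSeq.mono {I : Ideal R} {M : Type v} [AddCommGroup M] [Module R M] {m n : ℕ}
    (hmn : m ≤ n) (h : HasRegularSeq I M n) : HasRegularSeq I M m := by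
  obtain ⟨rs, hl, hI, hr⟩ := h
  refine ⟨rs.take m, by simp [hl, hmn], fun a ha => hI a (List.mem_of_mem_take ha), ?_⟩
  have := hr
  rw [← List.take_append_drop m rs, isWeaklyRegular_append_iff] at this
  exact this.1

/-- Over a Noetherian ring, an ideal without `M`-regular elements kills a nonzero element of the
finitely generated module `M`. -/
lemma exists_ne_zero_forall_smul_eq_zero [IsNoetherianRing R] {I : Ideal R} {M : Type v}
    [AddCommGroup M] [Module R M] [Module.Finite R M] (h : ∀ x ∈ I, ¬ IsSMulRegular M x) :
    ∃ u : M, u ≠ 0 ∧ ∀ x ∈ I, x • u = 0 := by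
  by_contra! hc
  have : Subsingleton ((R ⧸ I) →ₗ[R] M) := by
    refine subsingleton_of_forall_eq 0 fun f => ?_
    have h1 : f (Ideal.Quotient.mk I 1) = 0 := by
      by_contra h0
      obtain ⟨x, hx, hne⟩ := hc _ h0
      apply hne
      rw [← map_smul]
      have : x • (Ideal.Quotient.mk I 1) = 0 := by
        rw [Algebra.smul_def, Ideal.Quotient.algebraMap_eq, ← map_mul, mul_one,
          Ideal.Quotient.eq_zero_iff_mem]
        exact hx
      rw [this, map_zero]
    ext
    simpa using h1
  obtain ⟨r, hr, hreg⟩ := IsSMulRegular.subsingleton_linearMap_iff.1 this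
  rw [Ideal.annihilator_quotient] at hr
  exact h r hr hreg

/-- Lifting representatives lets an element of `M / fM` killed by `I` be handled through equations
in `M`, where it can be transferred to another quotient. -/
lemma exists_ne_zero_mk {M : Type v} [AddCommGroup M] [Module R M] {f : R} {I : Ideal R} :
    (∃ u : QuotSMulTop f M, u ≠ 0 ∧ ∀ x ∈ I, x • u = 0) ↔
      ∃ u : M, (∀ w, u ≠ f • w) ∧ ∀ x ∈ I, ∃ w, x • u = f • w := by
  have key : ∀ u : M, (Submodule.Quotient.mk u : QuotSMulTop f M) = 0 ↔ ∃ w, u = f • w := by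
    intro u
    rw [Submodule.Quotient.mk_eq_zero, Submodule.mem_smul_pointwise_iff_exists]
    simp [eq_comm]
  constructor
  · rintro ⟨u, hu, hx⟩
    obtain ⟨u, rfl⟩ := Submodule.Quotient.mk_surjective _ u
    refine ⟨u, fun w hw => hu ((key u).2 ⟨w, hw⟩), fun x hxI => (key _).1 ?_⟩
    rw [Submodule.Quotient.mk_smul]; exact hx x hxI
  · rintro ⟨u, hu, hx⟩
    refine ⟨Submodule.Quotient.mk u, fun h => ?_, fun x hxI => ?_⟩
    · obtain ⟨w, hw⟩ := (key u).1 h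
      exact hu w hw
    · rw [← Submodule.Quotient.mk_smul]; exact (key _).2 (hx x hxI)

lemma isSMulRegular_quotSMulTop_iff {M : Type v} [AddCommGroup M] [Module R M] {f z : R} :
    IsSMulRegular (QuotSMulTop f M) z ↔ ∀ u v : M, z • u = f • v → ∃ w, u = f • w := by
  rw [isSMulRegular_quotient_iff_mem_of_smul_mem]
  simp only [Submodule.mem_smul_pointwise_iff_exists, Submodule.mem_top, true_and]
  constructor
  · intro h u v huv
    obtain ⟨w, hw⟩ := h u ⟨v, huv.symm⟩
    exact ⟨w, hw.symm⟩
  · rintro h u ⟨v, hv⟩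
    obtain ⟨w, hw⟩ := h u v hv.symm
    exact ⟨w, hw.symm⟩

/-- `M / (f, g) M` does not depend on the order of `f` and `g`. -/
lemma nonempty_quotSMulTop_comm {M : Type v} [AddCommGroup M] [Module R M] (f g : R) :
    Nonempty (QuotSMulTop f (QuotSMulTop g M) ≃ₗ[R] QuotSMulTop g (QuotSMulTop f M)) := by
  have h : Ideal.ofList [g, f] = Ideal.ofList [f, g] := by
    simp only [Ideal.ofList_cons, Ideal.ofList_nil]
    rw [sup_bot_eq, sup_bot_eq, sup_comm]
  have e1 := Submodule.quotOfListConsSMulTopEquivQuotSMulTopInner M g [f]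
  have e2 := Submodule.quotOfListConsSMulTopEquivQuotSMulTopInner M f [g]
  have e3 : ∀ (a : R) (N : Type v) [AddCommGroup N] [Module R N],
      (N ⧸ Ideal.ofList [a] • (⊤ : Submodule R N)) ≃ₗ[R] QuotSMulTop a N := fun a N _ _ =>
    Submodule.quotEquivOfEq _ _ (by
      rw [Ideal.ofList_singleton, Submodule.ideal_span_singleton_smul])
  exact ⟨(e3 _ _).symm ≪≫ₗ e1.symm ≪≫ₗ
    Submodule.quotEquivOfEq _ _ (by rw [h]) ≪≫ₗ e2 ≪≫ₗ e3 _ _⟩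

lemma not_regular_of_forall {I : Ideal R} {M : Type v} [AddCommGroup M] [Module R M] {u : M}
    (hu : u ≠ 0) (h : ∀ x ∈ I, x • u = 0) {x : R} (hx : x ∈ I) : ¬ IsSMulRegular M x := by
  intro hr
  exact hu (hr (by simpa using h x hx))

/-- Exchange property: dividing by an arbitrary regular element lowers the maximal length of
regular sequences by one at most. -/
theorem HasRegularSeq.quotSMulTop [IsNoetherianRing R] {I : Ideal R} {m : ℕ} :
    ∀ {M : Type v} [AddCommGroup M] [Module R M] [Module.Finite R M],
      HasRegularSeq I M (m + 1) → ∀ {f : R}, f ∈ I → IsSMulRegular M f →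
      HasRegularSeq I (QuotSMulTop f M) m := by
  induction m using Nat.strong_induction_on with
  | _ m ih =>
  intro M _ _ _ hM f hf hfr
  rcases m with _ | m
  · exact hasRegularSeq_zero _ _
  obtain ⟨x, hx, hxr, hseq⟩ := hasRegularSeq_succ.1 hM
  obtain ⟨y, hy, hyr, -⟩ := hasRegularSeq_succ.1 hseq
  -- If `u` is such an element and `x • u = f • v`, then `v` is nonzero in `M / xM` and killed by
  -- `I`; but `y ∈ I` is regular there.
  have hfz : ¬ ∃ u : QuotSMulTop f M, u ≠ 0 ∧ ∀ x ∈ I, x • u = 0 := by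
    rw [exists_ne_zero_mk]
    rintro ⟨u, hu, hI⟩
    obtain ⟨v, hv⟩ := hI x hx
    have h2 : ∃ u : QuotSMulTop x M, u ≠ 0 ∧ ∀ x ∈ I, x • u = 0 := by
      rw [exists_ne_zero_mk]
      refine ⟨v, fun w hw => hu w (hxr ?_), fun a ha => ?_⟩
      · simp only [hv, hw]; rw [smul_comm]
      · obtain ⟨w, hw⟩ := hI a ha
        refine ⟨w, hfr ?_⟩
        simp only
        rw [smul_comm f a v, ← hv, smul_comm a x u, hw, smul_comm]
    obtain ⟨u, hu, hI⟩ := h2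
    exact not_regular_of_forall hu hI hy hyr
  -- Working on the product gives one `z` regular on all three modules; this replaces prime
  -- avoidance.
  obtain ⟨z, hz, hzr⟩ : ∃ z ∈ I, IsSMulRegular (M × QuotSMulTop x M × QuotSMulTop f M) z := by
    by_contra! hc
    obtain ⟨⟨u1, u2, u3⟩, hu, hI⟩ := exists_ne_zero_forall_smul_eq_zero hc
    simp only [Prod.smul_mk, Prod.mk_eq_zero] at hI
    by_cases h1 : u1 = 0
    · by_cases h2 : u2 = 0
      · refine hfz ⟨u3, fun h3 => hu (by simp [h1, h2, h3]), fun a ha => (hI a ha).2.2⟩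
      · exact not_regular_of_forall h2 (fun a ha => (hI a ha).2.1) hy hyr
    · exact not_regular_of_forall h1 (fun a ha => (hI a ha).1) hx hxr
  have hz1 : IsSMulRegular M z := fun a b h => by
    have := @hzr (a, 0, 0) (b, 0, 0) (by simpa using h)
    simpa using this
  have hz2 : IsSMulRegular (QuotSMulTop x M) z := fun a b h => by
    have := @hzr (0, a, 0) (0, b, 0) (by simpa using h)
    simpa using this
  have hz3 : IsSMulRegular (QuotSMulTop f M) z := fun a b h => by
    have := @hzr (0, 0, a) (0, 0, b) (by simpa using h)
    simpa using this
  have swap : ∀ {g : R}, IsSMulRegular M g → IsSMulRegular (QuotSMulTop g M) z →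
      IsSMulRegular (QuotSMulTop z M) g := by
    intro g hg hgz
    rw [isSMulRegular_quotSMulTop_iff] at hgz ⊢
    intro u v huv
    obtain ⟨w, hw⟩ := hgz v u huv.symm
    refine ⟨w, hg ?_⟩
    simp only
    rw [huv, hw, smul_comm]
  -- In the longer case `z` links `x` and `f`: the induction hypothesis divides `M / xM` by `z`,
  -- regular elements are swapped to get a sequence on `M / zM` starting with `x`, and the
  -- hypothesis again divides by `f`.
  rcases m with _ | m
  · exact hasRegularSeq_succ.2 ⟨z, hz, hz3, hasRegularSeq_zero _ _⟩
  have h1 : HasRegularSeq I (QuotSMulTop z (QuotSMulTop x M)) (m + 1) :=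
    ih (m + 1) (by omega) hseq hz hz2
  have h2 : HasRegularSeq I (QuotSMulTop z M) (m + 2) :=
    hasRegularSeq_succ.2 ⟨x, hx, swap hxr hz2, h1.congr (nonempty_quotSMulTop_comm z x).some⟩
  have h3 : HasRegularSeq I (QuotSMulTop f (QuotSMulTop z M)) (m + 1) :=
    ih (m + 1) (by omega) h2 hf (swap hfr hz3)
  exact hasRegularSeq_succ.2 ⟨z, hz, hz3, h3.congr (nonempty_quotSMulTop_comm f z).some⟩

/-- Over a Noetherian local ring, enlarging an ideal by one element raises the maximal length of
regular sequences by one at most. -/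
theorem HasRegularSeq.of_sup_span_singleton [IsNoetherianRing R] [IsLocalRing R] {I : Ideal R}
    {y : R} (hI : I ≤ IsLocalRing.maximalIdeal R) (hy : y ∈ IsLocalRing.maximalIdeal R) {m : ℕ} :
    ∀ {M : Type v} [AddCommGroup M] [Module R M] [Module.Finite R M],
      HasRegularSeq (I ⊔ Ideal.span {y}) M (m + 1) → HasRegularSeq I M m := by
  induction m with
  | zero => intros; exact hasRegularSeq_zero _ _
  | succ m ih =>
  intro M _ _ _ hM
  obtain ⟨w, hw, hwr, hseq⟩ := hasRegularSeq_succ.1 hM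
  obtain ⟨w', hw', hwr', -⟩ := hasRegularSeq_succ.1 hseq
  have hle : I ⊔ Ideal.span {y} ≤ IsLocalRing.maximalIdeal R :=
    sup_le hI ((Ideal.span_singleton_le_iff_mem _).2 hy)
  obtain ⟨f, hf, hfr⟩ : ∃ f ∈ I, IsSMulRegular M f := by
    by_contra! hc
    obtain ⟨u₀, hu₀, hIu₀⟩ := exists_ne_zero_forall_smul_eq_zero hc
    -- `N = (0 :_M I)` is nonzero, and `w = i + t y` acts on it as `t y`.
    let N : Submodule R M :=
      { carrier := {u | ∀ x ∈ I, x • u = 0}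
        add_mem' := fun ha hb x hx => by rw [smul_add, ha x hx, hb x hx, add_zero]
        zero_mem' := fun x _ => smul_zero x
        smul_mem' := fun c u hu x hx => by rw [smul_comm, hu x hx, smul_zero] }
    obtain ⟨i, hi, c, hc, rfl⟩ := Submodule.mem_sup.1 hw
    obtain ⟨t, rfl⟩ := Ideal.mem_span_singleton'.1 hc
    have hN0 : ∀ u ∈ N, (t * y) • u = 0 → u = 0 := fun u hu h => hwr (by
      simp only [smul_zero]
      rw [add_smul, hu i hi, h, add_zero])
    -- Nakayama: `y` lies in the maximal ideal, so `N = yN` would force `N = 0`.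
    have hex : ∃ u ∈ N, ∀ v ∈ N, u ≠ y • v := by
      by_contra! hcon
      have hN : N = ⊥ := by
        refine Submodule.eq_bot_of_le_smul_of_le_jacobson_bot (Ideal.span {y}) N
          (IsNoetherian.noetherian N) (fun u hu => ?_) ?_
        · obtain ⟨v, hvN, hv⟩ := hcon u hu
          rw [hv]
          exact Submodule.smul_mem_smul (Ideal.mem_span_singleton_self _) hvN
        · rw [IsLocalRing.jacobson_eq_maximalIdeal ⊥ bot_ne_top, Ideal.span_singleton_le_iff_mem]
          exact hy
      have : u₀ ∈ N := hIu₀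
      rw [hN] at this
      exact hu₀ this
    obtain ⟨u, hu, hne⟩ := hex
    have : ∃ u : QuotSMulTop (i + t * y) M, u ≠ 0 ∧ ∀ x ∈ I ⊔ Ideal.span {y}, x • u = 0 := by
      rw [exists_ne_zero_mk]
      -- `I` kills `t • u`, and `y • (t • u) = w • u` vanishes modulo `w`. If `t • u = w • v`, then
      -- regularity of `w` puts `v` in `N` and gives `u = y • v`, against the choice of `u`.
      refine ⟨t • u, fun v hv => ?_, fun x hx => ?_⟩
      · have hvN : v ∈ N := fun x hx => hwr (by
          simp only [smul_zero]
          rw [smul_comm, ← hv, smul_comm, hu x hx, smul_zero])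
        refine hne v hvN (sub_eq_zero.1 (hN0 _ (N.sub_mem hu (N.smul_mem y hvN)) ?_))
        rw [add_smul, hvN i hi, zero_add, mul_smul] at hv
        rw [mul_comm, mul_smul, smul_sub, hv, sub_self, smul_zero]
      · obtain ⟨i', hi', c', hc', rfl⟩ := Submodule.mem_sup.1 hx
        obtain ⟨t', rfl⟩ := Ideal.mem_span_singleton'.1 hc'
        refine ⟨t' • u, ?_⟩
        rw [add_smul, (N.smul_mem t hu : _) i' hi', zero_add, add_smul, (N.smul_mem t' hu : _) i hi,
          zero_add, smul_smul, smul_smul]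
        congr 1; ring
    obtain ⟨v, hv, hv'⟩ := this
    exact not_regular_of_forall hv hv' hw' hwr'
  have h1 := hM.quotSMulTop (f := f) (Ideal.mem_sup_left hf) hfr
  exact hasRegularSeq_succ.2 ⟨f, hf, hfr, ih h1⟩

lemma HasRegularSeq.of_sup_span_range [IsNoetherianRing R] [IsLocalRing R] {I : Ideal R} {n : ℕ}
    (y : Fin n → R) (hI : I ≤ IsLocalRing.maximalIdeal R)
    (hy : ∀ i, y i ∈ IsLocalRing.maximalIdeal R) {m : ℕ} {M : Type v} [AddCommGroup M] [Module R M]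
    [Module.Finite R M] (h : HasRegularSeq (I ⊔ Ideal.span (Set.range y)) M (m + n)) :
    HasRegularSeq I M m := by
  induction n generalizing I m with
  | zero => simpa using h
  | succ n ih =>
    have hspan : I ⊔ Ideal.span (Set.range y) =
        (I ⊔ Ideal.span {y 0}) ⊔ Ideal.span (Set.range fun i : Fin n => y i.succ) := by
      rw [sup_assoc, ← Ideal.span_union]
      congr 2
      ext x
      simp only [Set.mem_range, Fin.exists_fin_succ, Set.mem_union, Set.mem_singleton_iff]
      exact or_congr eq_comm Iff.rfl
    rw [hspan, show m + (n + 1) = (m + 1) + n by ring] at h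
    have := ih _ (sup_le hI ((Ideal.span_singleton_le_iff_mem _).2 (hy 0))) (fun i => hy _) h
    exact this.of_sup_span_singleton hI (hy 0)

/-- If a domain `A` is not saturated in the overring `B` along `J` (as witnessed by `z`), then
`J` has no regular sequences of length two, locally at `P`; hence a bound for the depth of `A`. -/
theorem length_le_of_conductor {A : Type u} {B : Type v} [CommRing A] [IsDomain A]
    [IsNoetherianRing A] [CommRing B] [IsDomain B] (φ : A →+* B) (hφ : Function.Injective φ)
    (P J : Ideal A) [P.IsPrime] {n : ℕ} (y : Fin n → A) (hP : P = J ⊔ Ideal.span (Set.range y))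
    (z : B) (hJ : ∀ a ∈ J, ∃ c, φ a * z = φ c) (hz : ∀ s ∉ P, ∀ c, φ s * z ≠ φ c)
    {rs : List A} (hrs : ∀ a ∈ rs, a ∈ P) (hreg : IsWeaklyRegular A rs) : rs.length ≤ n + 1 := by
  by_contra! hlen
  have hseq : HasRegularSeq P A (2 + n) :=
    HasRegularSeq.mono (by omega) ⟨rs, rfl, hrs, hreg⟩
  obtain ⟨rs', hl, hmem, hr⟩ := hseq
  -- The generators `y` can be removed one at a time only over a local ring.
  let L := Localization.AtPrime P
  have hmax : P.map (algebraMap A L) = IsLocalRing.maximalIdeal L :=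
    Localization.AtPrime.map_eq_maximalIdeal
  have hJP : J ≤ P := hP ▸ le_sup_left
  have hyP : ∀ i, y i ∈ P := fun i =>
    hP ▸ Ideal.mem_sup_right (Ideal.subset_span ⟨i, rfl⟩)
  have hsup : P.map (algebraMap A L) =
      J.map (algebraMap A L) ⊔ Ideal.span (Set.range fun i => algebraMap A L (y i)) := by
    refine (congrArg (Ideal.map (algebraMap A L)) hP).trans ?_
    rw [Ideal.map_sup, Ideal.map_span, ← Set.range_comp]
    rfl
  have hL : HasRegularSeq (P.map (algebraMap A L)) L (2 + n) := by
    refine ⟨rs'.map (algebraMap A L), by simpa using hl, ?_,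
      hr.of_isLocalization L P.primeCompl⟩
    intro a ha
    obtain ⟨b, hb, rfl⟩ := List.mem_map.1 ha
    exact Ideal.mem_map_of_mem _ (hmem b hb)
  rw [hsup] at hL
  have h2 : HasRegularSeq (J.map (algebraMap A L)) L 2 := by
    refine hL.of_sup_span_range _ ?_ ?_
    · rw [← hmax]; exact Ideal.map_mono hJP
    · intro i; rw [← hmax]; exact Ideal.mem_map_of_mem _ (hyP i)
  obtain ⟨f, hf, hfr, h1⟩ := hasRegularSeq_succ.1 h2
  obtain ⟨g, hg, hgr, -⟩ := hasRegularSeq_succ.1 h1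
  rw [isSMulRegular_quotSMulTop_iff] at hgr
  obtain ⟨⟨⟨j1, hj1⟩, s1⟩, e1⟩ := (IsLocalization.mem_map_algebraMap_iff P.primeCompl L).1 hf
  obtain ⟨⟨⟨j2, hj2⟩, s2⟩, e2⟩ := (IsLocalization.mem_map_algebraMap_iff P.primeCompl L).1 hg
  simp only at e1 e2
  obtain ⟨a1, ha1⟩ := hJ j1 hj1
  obtain ⟨a2, ha2⟩ := hJ j2 hj2
  have hcomm : j2 * a1 = j1 * a2 := hφ (by
    rw [map_mul, map_mul, ← ha1, ← ha2]; ring)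
  have hinj : Function.Injective (algebraMap A L) :=
    IsLocalization.injective L P.primeCompl_le_nonZeroDivisors
  -- With denominators cleared, this is `g (f z) = f (g z)` with `f z`, `g z` in `L`. Regularity of
  -- `g` modulo `f` puts `f z` in `f L`, hence `z` in `L`, contrary to `hz`.
  obtain ⟨w, hw⟩ := hgr (algebraMap A L (s2 * a1)) (algebraMap A L (s1 * a2)) (by
    simp only [smul_eq_mul, map_mul]
    calc g * (algebraMap A L s2 * algebraMap A L a1)
        = (g * algebraMap A L s2) * algebraMap A L a1 := by ring
      _ = algebraMap A L (j2 * a1) := by rw [e2, map_mul]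
      _ = (f * algebraMap A L s1) * algebraMap A L a2 := by rw [hcomm, e1, map_mul]
      _ = _ := by ring)
  obtain ⟨⟨c, s3⟩, e3⟩ := IsLocalization.surj P.primeCompl w
  simp only at e3
  have hA : ((s1 : A) * s2 * s3) * a1 = j1 * c := hinj (by
    simp only [map_mul, smul_eq_mul] at hw ⊢
    calc algebraMap A L s1 * algebraMap A L s2 * algebraMap A L s3 * algebraMap A L a1
        = (algebraMap A L s2 * algebraMap A L a1) * (algebraMap A L s1 * algebraMap A L s3) := by
          ring
      _ = (f * algebraMap A L s1) * (w * algebraMap A L s3) := by rw [hw]; ring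
      _ = _ := by rw [e1, e3])
  have hj0 : j1 ≠ 0 := by
    rintro rfl
    rw [map_zero] at e1
    have hs : algebraMap A L s1 ≠ 0 := fun h => s1.2 (by
      rw [map_eq_zero_iff _ hinj] at h
      rw [h]; exact P.zero_mem)
    have hL1 : f • (algebraMap A L s1) = f • (0 : L) := by simpa using e1
    exact hs (hfr hL1)
  refine hz (s1 * s2 * s3) (s1 * s2 * s3).2 c ?_
  have hφj : φ j1 ≠ 0 := fun h => hj0 ((map_eq_zero_iff _ hφ).1 h)
  apply mul_left_cancel₀ hφj
  calc φ j1 * (φ (s1 * s2 * s3) * z) = φ (s1 * s2 * s3) * (φ j1 * z) := by ring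
    _ = φ j1 * φ c := by rw [ha1, ← map_mul, ← map_mul, hA]

end Depth

/-! ### Kronecker normal form of a surjective pencil. -/

section Pencil

universe w

variable {k : Type*} [Field k]

/-- The pencil `(A, B)` of linear maps is surjective at every point of the projective line. -/
def PencilSurjective {V U : Type*} [AddCommGroup V] [Module k V] [AddCommGroup U] [Module k U]
    (A B : V →ₗ[k] U) : Prop :=
  ∀ q : Fin 2 → k, q ≠ 0 → Function.Surjective (q 1 • A - q 0 • B)

/-- Bases in which the pencil `(A, B)` is a direct sum of the blocks `L_{d i}` of Kronecker. -/
structure IsPencilBasis {V U : Type*} [AddCommGroup V] [Module k V] [AddCommGroup U] [Module k U]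
    (A B : V →ₗ[k] U) {ι : Type} {d : ι → ℕ} (b : (Σ i, Fin (d i + 1)) → V)
    (c : (Σ i, Fin (d i)) → U) : Prop where
  left_castSucc : ∀ i (j : Fin (d i)), A (b ⟨i, j.castSucc⟩) = c ⟨i, j⟩
  right_succ : ∀ i (j : Fin (d i)), B (b ⟨i, j.succ⟩) = c ⟨i, j⟩
  left_last : ∀ i, A (b ⟨i, Fin.last _⟩) = 0
  right_zero : ∀ i, B (b ⟨i, 0⟩) = 0

lemma PencilSurjective.surjective_right {V U : Type*} [AddCommGroup V] [Module k V]
    [AddCommGroup U] [Module k U] {A B : V →ₗ[k] U} (h : PencilSurjective A B) :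
    Function.Surjective B := by
  intro u
  obtain ⟨v, hv⟩ := h ![1, 0] (fun h => by simpa using congrFun h 0) (-u)
  exact ⟨v, by simpa using hv⟩

/-- Otherwise `A` factors through `B` as an endomorphism of `U`, and an eigenvalue `μ` of it
destroys surjectivity at `(μ : 1)`. This makes `U / A (ker B)` strictly smaller than `U`, so the
reduction terminates. -/
lemma PencilSurjective.exists_mem_ker_ne [IsAlgClosed k] {V U : Type*} [AddCommGroup V]
    [Module k V] [AddCommGroup U] [Module k U] [FiniteDimensional k U] [Nontrivial U]
    {A B : V →ₗ[k] U} (h : PencilSurjective A B) : ∃ v ∈ LinearMap.ker B, A v ≠ 0 := by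
  by_contra! hc
  obtain ⟨g, hg⟩ := B.exists_rightInverse_of_surjective
    (LinearMap.range_eq_top.2 h.surjective_right)
  have hAB : ∀ v, A v = A (g (B v)) := fun v => by
    rw [← sub_eq_zero, ← map_sub]
    apply hc
    rw [LinearMap.mem_ker, map_sub, sub_eq_zero]
    exact (LinearMap.congr_fun (f := B ∘ₗ g) hg (B v)).symm
  obtain ⟨μ, hμ⟩ := Module.End.exists_eigenvalue (A ∘ₗ g : U →ₗ[k] U)
  have hs : Function.Surjective ((A ∘ₗ g : U →ₗ[k] U) - μ • (LinearMap.id : U →ₗ[k] U)) := by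
    intro u
    obtain ⟨v, hv⟩ := h ![μ, 1] (fun h => by simpa using congrFun h 1) u
    refine ⟨B v, ?_⟩
    simp only [Matrix.cons_val_one, Matrix.cons_val_zero, LinearMap.sub_apply,
      LinearMap.smul_apply, one_smul] at hv
    simp only [LinearMap.sub_apply, LinearMap.comp_apply, LinearMap.smul_apply, LinearMap.id_apply,
      ← hAB, hv]
  have hi := LinearMap.injective_iff_surjective.2 hs
  obtain ⟨v, hv⟩ := hμ.exists_hasEigenvector
  apply hv.2
  apply hi
  rw [map_zero, LinearMap.sub_apply, LinearMap.smul_apply, LinearMap.id_apply, sub_eq_zero]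
  exact hv.apply_eq_smul

lemma PencilSurjective.quotient {V U : Type*} [AddCommGroup V] [Module k V] [AddCommGroup U]
    [Module k U] {A B : V →ₗ[k] U} (h : PencilSurjective A B) {g : U →ₗ[k] V}
    (hg : ∀ u, B (g u) = u) :
    PencilSurjective (((LinearMap.ker B).map A).mkQ ∘ₗ A ∘ₗ g) ((LinearMap.ker B).map A).mkQ := by
  intro q hq x
  obtain ⟨u, rfl⟩ := Submodule.mkQ_surjective _ x
  obtain ⟨v, rfl⟩ := h q hq u
  refine ⟨B v, ?_⟩
  simp only [LinearMap.sub_apply, LinearMap.smul_apply, LinearMap.comp_apply, map_sub, map_smul]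
  congr 2
  rw [← sub_eq_zero, ← map_sub, Submodule.mkQ_apply, Submodule.Quotient.mk_eq_zero, ← map_sub]
  refine Submodule.mem_map_of_mem ?_
  rw [LinearMap.mem_ker, map_sub, hg, sub_self]

/-- One step of the reduction of a pencil: from bases for the pencil induced on
`U → U / A (ker B)` to bases for the pencil `V → U`. -/
lemma exists_isPencilBasis_of_quotient {V U : Type w} [AddCommGroup V] [Module k V]
    [FiniteDimensional k V] [AddCommGroup U] [Module k U] [FiniteDimensional k U]
    {A B : V →ₗ[k] U} {g : U →ₗ[k] V} (hg : ∀ u, B (g u) = u)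
    {ι₁ : Type} [Fintype ι₁] {d₁ : ι₁ → ℕ} (b₁ : Module.Basis (Σ i, Fin (d₁ i + 1)) k U)
    (c₁ : Module.Basis (Σ i, Fin (d₁ i)) k (U ⧸ (LinearMap.ker B).map A))
    (h₁ : IsPencilBasis (((LinearMap.ker B).map A).mkQ ∘ₗ A ∘ₗ g) ((LinearMap.ker B).map A).mkQ
      b₁ c₁) :
    ∃ (ι : Type) (_ : Fintype ι) (d : ι → ℕ) (b : Module.Basis (Σ i, Fin (d i + 1)) k V)
      (c : Module.Basis (Σ i, Fin (d i)) k U), IsPencilBasis A B b c := by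
  have hβ : ∀ i, ∃ β ∈ LinearMap.ker B, A β = b₁ ⟨i, 0⟩ := fun i => by
    have := h₁.right_zero i
    rwa [Submodule.mkQ_apply, Submodule.Quotient.mk_eq_zero, Submodule.mem_map] at this
  choose β hβB hβA using hβ
  -- The block relations hold only modulo `A (ker B)`; correcting the lift `g (b₁ ⟨i, j⟩)` by an
  -- element of `ker B` makes them exact without changing its image under `B`.
  have hγ : ∀ i (j : Fin (d₁ i + 1)), ∃ γ, B γ = b₁ ⟨i, j⟩ ∧
      (∀ j' : Fin (d₁ i), j = j'.castSucc → A γ = b₁ ⟨i, j'.succ⟩) ∧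
      (j = Fin.last _ → A γ = 0) := by
    intro i j
    suffices ∃ u : U, A (g (b₁ ⟨i, j⟩)) - u ∈ (LinearMap.ker B).map A ∧
        (∀ j' : Fin (d₁ i), j = j'.castSucc → u = b₁ ⟨i, j'.succ⟩) ∧
        (j = Fin.last _ → u = 0) by
      obtain ⟨u, ⟨κ, hκ, hu⟩, h1, h2⟩ := this
      have hA : A (g (b₁ ⟨i, j⟩) - κ) = u := by rw [map_sub, hu, sub_sub_cancel]
      refine ⟨g (b₁ ⟨i, j⟩) - κ, ?_, fun j' hj => hA.trans (h1 j' hj), fun hj => hA.trans (h2 hj)⟩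
      rw [map_sub, hg, LinearMap.mem_ker.1 hκ, sub_zero]
    induction j using Fin.lastCases with
    | last =>
      refine ⟨0, ?_, fun j' hj => absurd hj.symm (Fin.castSucc_lt_last j').ne, fun _ => rfl⟩
      have := h₁.left_last i
      rw [sub_zero]
      rwa [LinearMap.comp_apply, LinearMap.comp_apply, Submodule.mkQ_apply,
        Submodule.Quotient.mk_eq_zero] at this
    | cast j =>
      refine ⟨b₁ ⟨i, j.succ⟩, ?_, fun j' hj => by rw [Fin.castSucc_injective _ hj],
        fun hj => absurd hj (Fin.castSucc_lt_last j).ne⟩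
      have := (h₁.left_castSucc i j).trans (h₁.right_succ i j).symm
      rwa [LinearMap.comp_apply, LinearMap.comp_apply, ← sub_eq_zero, ← map_sub,
        Submodule.mkQ_apply, Submodule.Quotient.mk_eq_zero] at this
  choose γ hγB hγA hγl using hγ
  let W := LinearMap.ker (A.domRestrict (LinearMap.ker B))
  let m := Module.finrank k W
  let ω : Module.Basis (Fin m) k W := Module.finBasis k W
  -- Every block `L_{d₁ i}` of the quotient pencil grows by one, with `β i` as its new first vector;
  -- a basis of `ker A ∩ ker B` contributes blocks `L_0`.
  let d : ι₁ ⊕ Fin m → ℕ := Sum.elim (fun i => d₁ i + 1) fun _ => 0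
  let b' : (i : ι₁ ⊕ Fin m) → Fin (d i + 1) → V := fun i =>
    match i with
    | .inl i => (Fin.cons (β i) (γ i) : Fin (d₁ i + 1 + 1) → V)
    | .inr i => fun _ => ((ω i : LinearMap.ker B) : V)
  let c' : (i : ι₁ ⊕ Fin m) → Fin (d i) → U := fun i =>
    match i with
    | .inl i => fun j : Fin (d₁ i + 1) => b₁ ⟨i, j⟩
    | .inr _ => fun j : Fin 0 => j.elim0
  have hsum : ∑ i, (d₁ i + 1) = Module.finrank k U := by
    rw [Module.finrank_eq_card_basis b₁]; simp
  have hsum₁ : ∑ i, d₁ i = Module.finrank k (U ⧸ (LinearMap.ker B).map A) := by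
    rw [Module.finrank_eq_card_basis c₁]; simp
  have hspanc : ⊤ ≤ Submodule.span k (Set.range fun x : Σ i, Fin (d i) => c' x.1 x.2) := by
    rw [← b₁.span_eq]
    refine Submodule.span_mono ?_
    rintro _ ⟨⟨i, j⟩, rfl⟩
    exact ⟨⟨Sum.inl i, j⟩, rfl⟩
  have hspanb : ⊤ ≤ Submodule.span k (Set.range fun x : Σ i, Fin (d i + 1) => b' x.1 x.2) := by
    set S := Submodule.span k (Set.range fun x : Σ i, Fin (d i + 1) => b' x.1 x.2)
    have hmem : ∀ i j, b' i j ∈ S := fun i j => Submodule.subset_span ⟨⟨i, j⟩, rfl⟩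
    have hβS : ∀ i, β i ∈ S := fun i => hmem (Sum.inl i) (0 : Fin (d₁ i + 1 + 1))
    have hγS : ∀ i j, γ i j ∈ S := fun i j => hmem (Sum.inl i) (j.succ : Fin (d₁ i + 1 + 1))
    have hωS : W.map (LinearMap.ker B).subtype ≤ S := by
      rintro _ ⟨x, hx, rfl⟩
      have := ω.sum_repr ⟨x, hx⟩
      rw [← Subtype.coe_mk x hx, ← this]
      simp only [AddSubmonoidClass.coe_finsetSum, map_sum]
      exact S.sum_mem fun i _ => S.smul_mem _ (hmem (Sum.inr i) 0)
    have hB : ∀ u : U, ∃ s ∈ S, B s = u := by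
      intro u
      refine ⟨∑ x, b₁.repr u x • γ x.1 x.2, S.sum_mem fun x _ => S.smul_mem _ (hγS _ _), ?_⟩
      rw [map_sum]
      conv_rhs => rw [← b₁.sum_repr u]
      exact Finset.sum_congr rfl fun x _ => by rw [map_smul, hγB]
    have hA : ∀ x ∈ LinearMap.ker B, ∃ s ∈ S, s ∈ LinearMap.ker B ∧ A s = A x := by
      intro x hx
      have h0 : ((LinearMap.ker B).map A).mkQ (A x) = 0 := by
        rw [Submodule.mkQ_apply, Submodule.Quotient.mk_eq_zero]
        exact Submodule.mem_map_of_mem hx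
      have hcoef : ∀ i (j : Fin (d₁ i)), b₁.repr (A x) ⟨i, j.succ⟩ = 0 := by
        have hrepr : ∀ u : U, ∀ y : Σ i, Fin (d₁ i), c₁.repr (((LinearMap.ker B).map A).mkQ u) y =
            b₁.repr u ⟨y.1, y.2.succ⟩ := by
          intro u y
          have : (c₁.coord y) ∘ₗ ((LinearMap.ker B).map A).mkQ =
              b₁.coord ⟨y.1, y.2.succ⟩ := by
            refine b₁.ext fun ⟨i, j⟩ => ?_
            induction j using Fin.cases with
            | zero =>
              rw [LinearMap.comp_apply, h₁.right_zero, map_zero, Module.Basis.coord_apply,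
                Module.Basis.repr_self, Finsupp.single_eq_of_ne]
              rintro ⟨⟩
            | succ j =>
              rw [LinearMap.comp_apply, h₁.right_succ, Module.Basis.coord_apply,
                Module.Basis.repr_self, Module.Basis.coord_apply, Module.Basis.repr_self]
              classical
              rw [Finsupp.single_apply, Finsupp.single_apply]
              congr 1
              obtain ⟨i', j'⟩ := y
              simp only [eq_iff_iff, Sigma.mk.injEq]
              constructor
              · rintro ⟨rfl, h⟩
                simpa using h
              · rintro ⟨rfl, h⟩
                simpa using h
          exact LinearMap.congr_fun this u
        intro i j
        rw [← hrepr (A x) ⟨i, j⟩, h0, map_zero, Finsupp.zero_apply]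
      refine ⟨∑ i, b₁.repr (A x) ⟨i, 0⟩ • β i, S.sum_mem fun i _ => S.smul_mem _ (hβS i),
        Submodule.sum_mem _ fun i _ => Submodule.smul_mem _ _ (hβB i), ?_⟩
      rw [map_sum]
      conv_rhs => rw [← b₁.sum_repr (A x)]
      rw [Fintype.sum_sigma]
      refine Finset.sum_congr rfl fun i _ => ?_
      rw [Fin.sum_univ_succ, map_smul, hβA, Finset.sum_eq_zero, add_zero]
      intro j _
      rw [hcoef, zero_smul]
    intro v _
    obtain ⟨s, hs, hsB⟩ := hB (B v)
    have hker : v - s ∈ LinearMap.ker B := by rw [LinearMap.mem_ker, map_sub, hsB, sub_self]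
    obtain ⟨t, ht, htB, htA⟩ := hA _ hker
    have hW : v - s - t ∈ S := by
      apply hωS
      refine ⟨⟨v - s - t, Submodule.sub_mem _ hker htB⟩, ?_, rfl⟩
      rw [SetLike.mem_coe, LinearMap.mem_ker, LinearMap.domRestrict_apply]
      simp only [map_sub A _ t, htA, sub_self]
    have := S.add_mem (S.add_mem hW ht) hs
    simpa using this
  have hcardc : Fintype.card (Σ i, Fin (d i)) = Module.finrank k U := by
    simp [d, ← hsum]
  -- Here `dim V = dim U + dim A (ker B) + dim W`, and the number of blocks of the quotient pencil
  -- is `dim U - dim (U / A (ker B)) = dim A (ker B)`.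
  have hcardb : Fintype.card (Σ i, Fin (d i + 1)) = Module.finrank k V := by
    have hBs : LinearMap.range B = ⊤ := LinearMap.range_eq_top.2 fun u => ⟨g u, hg u⟩
    have e1 := LinearMap.finrank_range_add_finrank_ker B
    have e2 := LinearMap.finrank_range_add_finrank_ker (A.domRestrict (LinearMap.ker B))
    rw [hBs, finrank_top] at e1
    rw [LinearMap.range_domRestrict] at e2
    have e3 := Submodule.finrank_quotient_add_finrank ((LinearMap.ker B).map A)
    rw [← hsum₁, ← hsum] at e3
    simp only [Fintype.card_sigma, Fintype.card_fin, Fintype.sum_sum_type, d, Sum.elim_inl,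
      Sum.elim_inr, Finset.sum_const, Finset.card_univ, zero_add, smul_eq_mul, mul_one]
    rw [← e1, ← e2, ← hsum]
    simp only [Finset.sum_add_distrib, Finset.sum_const, Finset.card_univ, smul_eq_mul,
      mul_one] at e3 ⊢
    change _ + m = _ + (_ + m)
    omega
  refine ⟨ι₁ ⊕ Fin m, inferInstance, d, basisOfTopLeSpanOfCardEqFinrank _ hspanb hcardb,
    basisOfTopLeSpanOfCardEqFinrank _ hspanc hcardc, ?_⟩
  rw [coe_basisOfTopLeSpanOfCardEqFinrank, coe_basisOfTopLeSpanOfCardEqFinrank]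
  have hωA : ∀ i, A (ω i : LinearMap.ker B) = 0 := fun i => (ω i).2
  have hωB : ∀ i, B (ω i : LinearMap.ker B) = 0 := fun i => (ω i : LinearMap.ker B).2
  constructor
  · rintro (i | i) j
    · change A ((Fin.cons (β i) (γ i) : Fin (d₁ i + 1 + 1) → V) (j : Fin (d₁ i + 1)).castSucc) =
        b₁ ⟨i, j⟩
      change Fin (d₁ i + 1) at j
      induction j using Fin.cases with
      | zero => exact hβA i
      | succ j => exact hγA i j.castSucc j rfl
    · exact (j : Fin 0).elim0
  · rintro (i | i) j
    · exact hγB i j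
    · exact (j : Fin 0).elim0
  · rintro (i | i)
    · exact hγl i _ rfl
    · exact hωA i
  · rintro (i | i)
    · exact hβB i
    · exact hωB i

/-- Kronecker: a pencil of linear maps which is surjective at all points of the projective line
is a direct sum of blocks `L_{d i}`. -/
theorem PencilSurjective.exists_isPencilBasis [IsAlgClosed k] {V U : Type w} [AddCommGroup V]
    [Module k V] [FiniteDimensional k V] [AddCommGroup U] [Module k U] [FiniteDimensional k U]
    {A B : V →ₗ[k] U} (h : PencilSurjective A B) :
    ∃ (ι : Type) (_ : Fintype ι) (d : ι → ℕ) (b : Module.Basis (Σ i, Fin (d i + 1)) k V)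
      (c : Module.Basis (Σ i, Fin (d i)) k U), IsPencilBasis A B b c := by
  induction hn : Module.finrank k U using Nat.strong_induction_on generalizing V U with
  | _ n ih =>
  rcases subsingleton_or_nontrivial U with hU | hU
  · let e : (Σ _ : Fin (Module.finrank k V), Fin (0 + 1)) ≃ Fin (Module.finrank k V) :=
      ⟨fun x => x.1, fun i => ⟨i, 0⟩, fun ⟨i, j⟩ => congrArg (Sigma.mk i) (Fin.ext (by simp)),
        fun _ => rfl⟩
    have : IsEmpty (Σ _ : Fin (Module.finrank k V), Fin 0) := ⟨fun x => x.2.elim0⟩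
    refine ⟨Fin (Module.finrank k V), inferInstance, fun _ => 0,
      (Module.finBasis k V).reindex e.symm, Module.Basis.empty U, ?_⟩
    constructor
    · exact fun i j => Subsingleton.elim _ _
    · exact fun i j => Subsingleton.elim _ _
    · exact fun i => Subsingleton.elim _ _
    · exact fun i => Subsingleton.elim _ _
  · obtain ⟨v, hv, hAv⟩ := h.exists_mem_ker_ne
    obtain ⟨g, hg⟩ := B.exists_rightInverse_of_surjective
      (LinearMap.range_eq_top.2 h.surjective_right)
    have hg' : ∀ u, B (g u) = u := fun u => LinearMap.congr_fun hg u
    have hlt : Module.finrank k (U ⧸ (LinearMap.ker B).map A) < n := by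
      have := Submodule.finrank_quotient_add_finrank ((LinearMap.ker B).map A)
      have hpos : 0 < Module.finrank k ((LinearMap.ker B).map A) := by
        rw [Module.finrank_pos_iff_exists_ne_zero]
        exact ⟨⟨A v, Submodule.mem_map_of_mem hv⟩, fun h0 => hAv (congrArg Subtype.val h0)⟩
      omega
    obtain ⟨ι₁, _, d₁, b₁, c₁, h₁⟩ := ih _ hlt (h.quotient hg') rfl
    exact exists_isPencilBasis_of_quotient hg' b₁ c₁ h₁

end Pencil

/-! ### Scrolls as loci of surjective pencils. -/

section ScrollPencil

universe w

variable {k : Type*} [Field k]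

/-- The union over `q ∈ ℙ¹` of the kernels of `q₁ A - q₀ B`. -/
def pencilLocus {V U : Type*} [AddCommGroup V] [Module k V] [AddCommGroup U] [Module k U]
    (A B : V →ₗ[k] U) : Set (ℙ k V) :=
  {x | ∃ q : Fin 2 → k, q ≠ 0 ∧ x.submodule ≤ LinearMap.ker (q 1 • A - q 0 • B)}

/-- The recursion determines `x` from its first entry if `q 0 ≠ 0` and from its last entry
otherwise. Hence each Kronecker block has as kernel the line of a point on a rational normal curve.
-/
lemma exists_eq_mul_pow {n : ℕ} {x : Fin (n + 1) → k} {q : Fin 2 → k} (hq : q ≠ 0)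
    (h : ∀ j : Fin n, q 1 * x j.castSucc = q 0 * x j.succ) :
    ∃ a, ∀ j : Fin (n + 1), x j = a * (q 0 ^ (n - (j : ℕ)) * q 1 ^ (j : ℕ)) := by
  by_cases h0 : q 0 = 0
  · have h1 : q 1 ≠ 0 := fun h1 => hq (by ext i; fin_cases i <;> simp [h0, h1])
    refine ⟨x (Fin.last n) / q 1 ^ n, fun j => ?_⟩
    induction j using Fin.lastCases with
    | last => simp [h1]
    | cast j =>
      have hx := h j
      rw [h0, zero_mul] at hx
      have hj : n - (j : ℕ) ≠ 0 := by omega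
      simp [h0, hj, (mul_eq_zero.1 hx).resolve_left h1]
  · refine ⟨x 0 / q 0 ^ n, fun j => ?_⟩
    induction j using Fin.induction with
    | zero => simp [h0]
    | succ j ih =>
      have hx := h j
      rw [ih] at hx
      apply mul_left_cancel₀ h0
      rw [← hx]
      have : n - ((j.castSucc : Fin (n + 1)) : ℕ) = (n - (j.succ : ℕ)) + 1 := by
        simp only [Fin.val_castSucc, Fin.val_succ]; omega
      rw [this, Fin.val_succ, Fin.val_castSucc]
      ring

section Basis

variable {V : Type*} [AddCommGroup V] [Module k V] {l v : ℕ} {d : Fin l → ℕ}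
  (b : Module.Basis ((Σ i : Fin l, Fin (d i + 1)) ⊕ Fin v) k V)

/-- The first row of the matrix of linear forms whose `2 × 2` minors define the scroll. -/
def scrollLeft : V →ₗ[k] ((Σ i : Fin l, Fin (d i)) → k) :=
  LinearMap.pi fun x => b.coord (Sum.inl ⟨x.1, x.2.castSucc⟩)

/-- The second row of the matrix of linear forms whose `2 × 2` minors define the scroll. -/
def scrollRight : V →ₗ[k] ((Σ i : Fin l, Fin (d i)) → k) :=
  LinearMap.pi fun x => b.coord (Sum.inl ⟨x.1, x.2.succ⟩)

lemma mem_ker_scrollPencil {q : Fin 2 → k} {x : V} :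
    x ∈ LinearMap.ker (q 1 • scrollLeft b - q 0 • scrollRight b) ↔
      ∀ i (j : Fin (d i)), q 1 * b.repr x (Sum.inl ⟨i, j.castSucc⟩) =
        q 0 * b.repr x (Sum.inl ⟨i, j.succ⟩) := by
  rw [LinearMap.mem_ker, funext_iff]
  simp only [scrollLeft, scrollRight, LinearMap.sub_apply, LinearMap.smul_apply, Pi.sub_apply,
    Pi.smul_apply, LinearMap.pi_apply, Module.Basis.coord_apply, smul_eq_mul, Pi.zero_apply,
    sub_eq_zero]
  exact ⟨fun h i j => h ⟨i, j⟩, fun h y => h y.1 y.2⟩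

lemma repr_curvePoint (i i' : Fin l) (j : Fin (d i' + 1)) (q : Fin 2 → k) :
    b.repr (curvePoint b i q) (Sum.inl ⟨i', j⟩) =
      if i = i' then q 0 ^ (d i' - (j : ℕ)) * q 1 ^ (j : ℕ) else 0 := by
  classical
  simp only [curvePoint, map_sum, map_smul, Module.Basis.repr_self, Finsupp.coe_finsetSum,
    Finset.sum_apply, Finsupp.smul_apply, Finsupp.single_apply, smul_eq_mul, mul_ite, mul_one,
    mul_zero, Sum.inl.injEq]
  split_ifs with h
  · subst h
    rw [Finset.sum_eq_single j] <;> simp +contextual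
  · refine Finset.sum_eq_zero fun j' _ => ?_
    rw [if_neg]
    rintro h'
    exact h (congrArg Sigma.fst h')

lemma mem_vertexSpace_iff {x : V} :
    x ∈ vertexSpace b ↔ ∀ y, b.repr x (Sum.inl y) = 0 := by
  constructor
  · intro hx y
    induction hx using Submodule.span_induction with
    | mem x h =>
      obtain ⟨j, rfl⟩ := h
      simp
    | zero => simp
    | add x y _ _ hx hy => simp [hx, hy]
    | smul a x _ hx => simp [hx]
  · intro h
    rw [← b.sum_repr x, Fintype.sum_sum_type, Finset.sum_eq_zero, zero_add]
    · exact Submodule.sum_mem _ fun j _ => Submodule.smul_mem _ _ (Submodule.subset_span ⟨j, rfl⟩)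
    · intro y _
      rw [h, zero_smul]

lemma rulingSpace_eq_ker {q : Fin 2 → k} (hq : q ≠ 0) :
    rulingSpace b q = LinearMap.ker (q 1 • scrollLeft b - q 0 • scrollRight b) := by
  apply le_antisymm
  · refine sup_le (Submodule.span_le.2 ?_) (fun x hx => ?_)
    · rintro _ ⟨i, rfl⟩
      rw [SetLike.mem_coe, mem_ker_scrollPencil]
      intro i' j
      rw [repr_curvePoint, repr_curvePoint]
      split_ifs with h
      · have : d i' - ((j.castSucc : Fin (d i' + 1)) : ℕ) = (d i' - (j.succ : ℕ)) + 1 := by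
          simp only [Fin.val_castSucc, Fin.val_succ]; omega
        rw [this, Fin.val_succ, Fin.val_castSucc]
        ring
      · simp
    · rw [mem_vertexSpace_iff] at hx
      rw [mem_ker_scrollPencil]
      simp [hx]
  · intro x hx
    rw [mem_ker_scrollPencil] at hx
    rw [← b.sum_repr x, Fintype.sum_sum_type, Fintype.sum_sigma]
    refine Submodule.add_mem_sup (Submodule.sum_mem _ fun i _ => ?_)
      (Submodule.sum_mem _ fun j _ => Submodule.smul_mem _ _ (Submodule.subset_span ⟨j, rfl⟩))
    obtain ⟨a, ha⟩ := exists_eq_mul_pow (x := fun j => b.repr x (Sum.inl ⟨i, j⟩)) hq (hx i)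
    have : ∑ j, b.repr x (Sum.inl ⟨i, j⟩) • b (Sum.inl ⟨i, j⟩) = a • curvePoint b i q := by
      rw [curvePoint, Finset.smul_sum]
      exact Finset.sum_congr rfl fun j _ => by rw [ha, smul_smul]
    rw [this]
    exact Submodule.smul_mem _ _ (Submodule.subset_span ⟨i, rfl⟩)

lemma scrollCone_eq_pencilLocus : scrollCone b = pencilLocus (scrollLeft b) (scrollRight b) := by
  ext x
  exact exists_congr fun q => and_congr_right fun hq => by rw [rulingSpace_eq_ker b hq]

lemma finrank_vertexSpace : Module.finrank k (vertexSpace b) = v := by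
  have := finrank_span_eq_card (b.linearIndependent.comp _ Sum.inr_injective)
  rwa [Fintype.card_fin] at this

lemma finrank_eq_of_scrollBasis
    (b : Module.Basis ((Σ i : Fin l, Fin (d i + 1)) ⊕ Fin v) k V) : Module.finrank k V = (∑ i, d i) + l + v := by
  rw [Module.finrank_eq_card_basis b]
  simp [Finset.sum_add_distrib]

/-- The kernel is a ruling, spanned by `l` curve points and the vertex, so has dimension at most `l
+ v`; rank-nullity gives the full rank `∑ d i`. -/
lemma pencilSurjective_scroll : PencilSurjective (scrollLeft b) (scrollRight b) := by
  intro q hq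
  have : FiniteDimensional k V := b.finiteDimensional_of_finite
  rw [← LinearMap.range_eq_top]
  apply Submodule.eq_top_of_finrank_eq
  apply le_antisymm (Submodule.finrank_le _)
  have h1 := LinearMap.finrank_range_add_finrank_ker (q 1 • scrollLeft b - q 0 • scrollRight b)
  rw [← rulingSpace_eq_ker b hq, finrank_eq_of_scrollBasis b] at h1
  have h2 : Module.finrank k (rulingSpace b q) ≤ l + v := by
    refine (Submodule.finrank_add_le_finrank_add_finrank _ _).trans ?_
    rw [finrank_vertexSpace]
    gcongr
    exact (finrank_range_le_card _).trans (by simp)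
  rw [Module.finrank_fintype_fun_eq_card]
  simp only [Fintype.card_sigma, Fintype.card_fin]
  omega

/-- The first row sees all curve coordinates of a block but the last, and the second row sees the
last because `d i ≥ 1`. -/
lemma ker_inf_ker_scroll (hd : ∀ i, 1 ≤ d i) :
    LinearMap.ker (scrollLeft b) ⊓ LinearMap.ker (scrollRight b) = vertexSpace b := by
  ext x
  rw [mem_vertexSpace_iff, Submodule.mem_inf, LinearMap.mem_ker, LinearMap.mem_ker]
  simp only [funext_iff, scrollLeft, scrollRight, LinearMap.pi_apply, Module.Basis.coord_apply,
    Pi.zero_apply]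
  constructor
  · rintro ⟨h1, h2⟩ ⟨i, j⟩
    induction j using Fin.lastCases with
    | last =>
      obtain ⟨m, hm⟩ : ∃ m, d i = m + 1 := ⟨d i - 1, by have := hd i; omega⟩
      have h3 := h2 ⟨i, ⟨d i - 1, by omega⟩⟩
      convert! h3 using 5
      simp only [Fin.succ_mk, Fin.last, Fin.mk.injEq]
      omega
    | cast j => exact h1 ⟨i, j⟩
  · intro h
    exact ⟨fun _ => h _, fun _ => h _⟩

end Basis

lemma IsPencilBasis.mem_ker_iff {V U : Type*} [AddCommGroup V] [Module k V] [AddCommGroup U]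
    [Module k U] {A B : V →ₗ[k] U} {ι : Type} {d : ι → ℕ}
    {b : Module.Basis (Σ i, Fin (d i + 1)) k V} {c : Module.Basis (Σ i, Fin (d i)) k U}
    (h : IsPencilBasis A B b c) {s t : k} {x : V} :
    x ∈ LinearMap.ker (t • A - s • B) ↔
      ∀ i (j : Fin (d i)), t * b.repr x ⟨i, j.castSucc⟩ = s * b.repr x ⟨i, j.succ⟩ := by
  classical
  have hA : ∀ y : Σ i, Fin (d i), c.repr (A x) y = b.repr x ⟨y.1, y.2.castSucc⟩ := by
    intro y
    have : c.coord y ∘ₗ A = b.coord ⟨y.1, y.2.castSucc⟩ := by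
      refine b.ext fun ⟨i, j⟩ => ?_
      induction j using Fin.lastCases with
      | last =>
        rw [LinearMap.comp_apply, h.left_last, map_zero, Module.Basis.coord_apply,
          Module.Basis.repr_self, Finsupp.single_eq_of_ne]
        obtain ⟨i', j'⟩ := y
        intro e
        rw [Sigma.mk.injEq] at e
        obtain ⟨rfl, e⟩ := e
        exact (Fin.castSucc_lt_last j').ne (eq_of_heq e)
      | cast j =>
        rw [LinearMap.comp_apply, h.left_castSucc, Module.Basis.coord_apply,
          Module.Basis.repr_self, Module.Basis.coord_apply, Module.Basis.repr_self,
          Finsupp.single_apply, Finsupp.single_apply]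
        congr 1
        obtain ⟨i', j'⟩ := y
        simp only [eq_iff_iff, Sigma.mk.injEq]
        constructor
        · rintro ⟨rfl, h⟩
          simpa using h
        · rintro ⟨rfl, h⟩
          simpa using h
    exact LinearMap.congr_fun this x
  have hB : ∀ y : Σ i, Fin (d i), c.repr (B x) y = b.repr x ⟨y.1, y.2.succ⟩ := by
    intro y
    have : c.coord y ∘ₗ B = b.coord ⟨y.1, y.2.succ⟩ := by
      refine b.ext fun ⟨i, j⟩ => ?_
      induction j using Fin.cases with
      | zero =>
        rw [LinearMap.comp_apply, h.right_zero, map_zero, Module.Basis.coord_apply,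
          Module.Basis.repr_self, Finsupp.single_eq_of_ne]
        rintro ⟨⟩
      | succ j =>
        rw [LinearMap.comp_apply, h.right_succ, Module.Basis.coord_apply,
          Module.Basis.repr_self, Module.Basis.coord_apply, Module.Basis.repr_self,
          Finsupp.single_apply, Finsupp.single_apply]
        congr 1
        obtain ⟨i', j'⟩ := y
        simp only [eq_iff_iff, Sigma.mk.injEq]
        constructor
        · rintro ⟨rfl, h⟩
          simpa using h
        · rintro ⟨rfl, h⟩
          simpa using h
    exact LinearMap.congr_fun this x
  rw [LinearMap.mem_ker, c.ext_elem_iff]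
  simp only [LinearMap.sub_apply, LinearMap.smul_apply, map_sub, map_smul, Finsupp.sub_apply,
    Finsupp.smul_apply, hA, hB, map_zero, Finsupp.zero_apply, sub_eq_zero, smul_eq_mul]
  exact ⟨fun h i j => h ⟨i, j⟩, fun h y => h y.1 y.2⟩

/-- The locus of a surjective pencil is a cone over a rational normal scroll. -/
theorem PencilSurjective.exists_scrollBasis [IsAlgClosed k] {V U : Type w} [AddCommGroup V]
    [Module k V] [FiniteDimensional k V] [AddCommGroup U] [Module k U] [FiniteDimensional k U]
    [Nontrivial U] {A B : V →ₗ[k] U} (h : PencilSurjective A B) :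
    ∃ (l v : ℕ) (d : Fin l → ℕ) (b : Module.Basis ((Σ i : Fin l, Fin (d i + 1)) ⊕ Fin v) k V),
      1 ≤ l ∧ (∀ i, 1 ≤ d i) ∧ pencilLocus A B = scrollCone b ∧
      LinearMap.ker A ⊓ LinearMap.ker B = vertexSpace b ∧
      Module.finrank k V = Module.finrank k U + l + v := by
  classical
  obtain ⟨ι, _, d, b, c, hbc⟩ := h.exists_isPencilBasis
  -- Blocks with `d i ≠ 0` supply the rational normal curves; each block with `d i = 0` has a single
  -- basis vector, which goes to the vertex.
  let f := (Fintype.equivFin {i : ι // d i ≠ 0}).symm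
  let g := (Fintype.equivFin {i : ι // ¬ d i ≠ 0}).symm
  let F : (Σ i, Fin (d (f i).1 + 1)) ⊕ Fin (Fintype.card {i : ι // ¬ d i ≠ 0}) →
      Σ i, Fin (d i + 1) := Sum.elim (fun x => ⟨(f x.1).1, x.2⟩) fun j => ⟨(g j).1, 0⟩
  have hF : Function.Bijective F := by
    constructor
    · rintro (⟨i, j⟩ | j) (⟨i', j'⟩ | j') e
      · simp only [F, Sum.elim_inl, Sigma.mk.injEq] at e
        obtain ⟨e1, e2⟩ := e
        have := f.injective (Subtype.ext e1)
        subst this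
        simpa using e2
      · have e1 : (f i).1 = (g j').1 := congrArg Sigma.fst e
        exact absurd (e1 ▸ (f i).2) (g j').2
      · have e1 : (g j).1 = (f i').1 := congrArg Sigma.fst e
        exact absurd (e1 ▸ (f i').2) (g j).2
      · have e1 : (g j).1 = (g j').1 := congrArg Sigma.fst e
        rw [g.injective (Subtype.ext e1)]
    · rintro ⟨i, j⟩
      by_cases hi : d i ≠ 0
      · obtain ⟨i', hi'⟩ := f.surjective ⟨i, hi⟩
        have : (f i').1 = i := congrArg Subtype.val hi'
        subst this
        exact ⟨Sum.inl ⟨i', j⟩, rfl⟩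
      · obtain ⟨i', hi'⟩ := g.surjective ⟨i, hi⟩
        have : (g i').1 = i := congrArg Subtype.val hi'
        subst this
        refine ⟨Sum.inr i', congrArg (Sigma.mk _) (Fin.ext ?_)⟩
        rw [Fin.val_zero]
        have := j.2
        omega
  let E := Equiv.ofBijective F hF
  let b' := b.reindex E.symm
  have hd : ∀ i, 1 ≤ d (f i).1 := fun i => Nat.one_le_iff_ne_zero.2 (f i).2
  have hrepr : ∀ x y, b'.repr x y = b.repr x (F y) := fun x y => by
    simp only [b', Module.Basis.repr_reindex_apply, Equiv.symm_symm]
    rfl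
  have hker : ∀ (q : Fin 2 → k), LinearMap.ker (q 1 • A - q 0 • B) =
      LinearMap.ker (q 1 • scrollLeft b' - q 0 • scrollRight b') := by
    intro q
    ext x
    rw [hbc.mem_ker_iff, mem_ker_scrollPencil]
    simp only [hrepr]
    constructor
    · intro hx i j
      exact hx (f i).1 j
    · intro hx i j
      have hi : d i ≠ 0 := fun h0 => by have := j.2; omega
      obtain ⟨i', hi'⟩ := f.surjective ⟨i, hi⟩
      have : (f i').1 = i := congrArg Subtype.val hi'
      subst this
      exact hx i' j
  have hfin : Module.finrank k U = ∑ i, d (f i).1 := by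
    rw [Module.finrank_eq_card_basis c]
    simp only [Fintype.card_sigma, Fintype.card_fin]
    rw [← Fintype.sum_subtype_add_sum_subtype (fun i => d i ≠ 0), Equiv.sum_comp f (fun i => d i.1)]
    rw [Finset.sum_eq_zero (s := (Finset.univ : Finset {i : ι // ¬ d i ≠ 0})), add_zero]
    rintro ⟨i, hi⟩ _
    exact not_not.1 hi
  refine ⟨_, _, fun i => d (f i).1, b', ?_, hd, ?_, ?_, ?_⟩
  · by_contra hl
    have hpos : 0 < Module.finrank k U := Module.finrank_pos
    rw [hfin, Finset.sum_eq_zero] at hpos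
    · exact lt_irrefl _ hpos
    · rintro ⟨i, hi⟩ _
      omega
  · rw [scrollCone_eq_pencilLocus]
    simp only [pencilLocus, hker]
  · rw [← ker_inf_ker_scroll b' hd]
    -- The parameters `(0, 1)` and `(1, 0)` recover the kernels of the two rows separately.
    have h1 := hker ![0, 1]
    have h2 := hker ![1, 0]
    simp only [Matrix.cons_val_one, Matrix.cons_val_zero, one_smul, zero_smul, sub_zero, zero_sub,
      LinearMap.ker_neg] at h1 h2
    rw [h1, h2]
  · rw [finrank_eq_of_scrollBasis b', hfin]

end ScrollPencil

/-! ### Krull dimension of integral extensions and of parametrized domains. -/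

section Dimension

/-- Lying over and going up lift chains of primes to `S`; incomparability keeps chains strict on
contraction to `R`. -/
lemma ringKrullDim_eq_of_isIntegral {R S : Type*} [CommRing R] [CommRing S] [Algebra R S]
    [Algebra.IsIntegral R S] (h : Function.Injective (algebraMap R S)) :
    ringKrullDim R = ringKrullDim S := by
  apply le_antisymm
  · refine iSup_le fun p => ?_
    obtain ⟨Q, -, hQ, hQp⟩ := Ideal.exists_ideal_over_prime_of_isIntegral
      (S := S) p.head.asIdeal ⊥ (by
        rw [← RingHom.ker_eq_comap_bot, (RingHom.injective_iff_ker_eq_bot _).1 h]; exact bot_le)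
    have : Q.LiesOver (RelSeries.head p).asIdeal := ⟨hQp.symm⟩
    obtain ⟨L, hL, -⟩ := Ideal.exists_ltSeries_of_hasGoingUp p Q
    rw [← hL]
    exact Order.LTSeries.length_le_krullDim L
  · refine Order.krullDim_le_of_strictMono (PrimeSpectrum.comap (algebraMap R S)) fun P Q hPQ => ?_
    exact Ideal.IsIntegral.comap_lt_comap hPQ

/-- A finitely generated `k`-algebra over which the polynomial ring in the variables `σ` is
algebraic has Krull dimension `#σ`. -/
lemma ringKrullDim_eq_card_of_isAlgebraic {k A : Type*} [Field k] [CommRing A] [Algebra k A]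
    [Algebra.FiniteType k A] {σ : Type} [Fintype σ] (f : A →ₐ[k] MvPolynomial σ k)
    (hf : Function.Injective f)
    (halg : ∀ i, ∃ a b : A, f a ≠ 0 ∧ f a * MvPolynomial.X i = f b) :
    ringKrullDim A = Fintype.card σ := by
  have hdom : IsDomain A := hf.isDomain f.toRingHom
  -- Noether normalization: `n` is both the Krull dimension and the transcendence degree of `A`, and
  -- the latter equals `#σ` by algebraicity.
  obtain ⟨n, g, hg, hint⟩ := exists_integral_inj_algHom_of_fg k A
  let _ := g.toRingHom.toAlgebra
  let _ := f.toRingHom.toAlgebra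
  have : Algebra.IsIntegral (MvPolynomial (Fin n) k) A := ⟨hint⟩
  have : IsScalarTower k (MvPolynomial (Fin n) k) A := IsScalarTower.of_algebraMap_eq
    fun x => (g.commutes x).symm
  have : IsScalarTower k A (MvPolynomial σ k) := IsScalarTower.of_algebraMap_eq
    fun x => (f.commutes x).symm
  have : FaithfulSMul (MvPolynomial (Fin n) k) A :=
    (faithfulSMul_iff_algebraMap_injective _ _).2 hg
  have : FaithfulSMul A (MvPolynomial σ k) :=
    (faithfulSMul_iff_algebraMap_injective _ _).2 hf
  have : Algebra.IsAlgebraic A (MvPolynomial σ k) := by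
    refine ⟨fun p => ?_⟩
    induction p using MvPolynomial.induction_on with
    | C a => 
      have := isAlgebraic_algebraMap (A := MvPolynomial σ k) (algebraMap k A a)
      rwa [← IsScalarTower.algebraMap_apply] at this
    | add p q hp hq => exact hp.add hq
    | mul_X p i hp =>
      refine hp.mul ?_
      obtain ⟨a, b, ha, hab⟩ := halg i
      refine ⟨Polynomial.C a * Polynomial.X - Polynomial.C b, fun h0 => ha ?_, ?_⟩
      · have := congrArg (fun p => p.coeff 1) h0
        simp [Polynomial.coeff_C] at this
        rw [this, map_zero]
      · simp only [map_sub, map_mul, Polynomial.aeval_C, Polynomial.aeval_X]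
        exact sub_eq_zero.2 hab
  have hdim := ringKrullDim_eq_of_isIntegral (R := MvPolynomial (Fin n) k) (S := A) hg
  have h1 := lift_trdeg_add_eq k (MvPolynomial (Fin n) k) A
  have h2 := lift_trdeg_add_eq k A (MvPolynomial σ k)
  have h3 : Algebra.trdeg (MvPolynomial (Fin n) k) A = 0 := trdeg_eq_zero
  have h4 : Algebra.trdeg A (MvPolynomial σ k) = 0 := trdeg_eq_zero
  rw [h3, MvPolynomial.trdeg_of_isDomain] at h1
  rw [h4, MvPolynomial.trdeg_of_isDomain] at h2
  rw [← hdim, MvPolynomial.ringKrullDim_of_isNoetherianRing, ringKrullDim_eq_zero_of_field,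
    zero_add]
  have : n = Fintype.card σ := by
    simp at h1 h2
    exact_mod_cast h1.trans h2
  simp [this]

end Dimension

/-! ### Linear functionals as polynomials. -/

section LinForm

variable {k : Type*} [Field k] {n : ℕ}

/-- A linear functional as a linear form. -/
def linForm : Module.Dual k (Fin n → k) →ₗ[k] MvPolynomial (Fin n) k where
  toFun f := ∑ m, MvPolynomial.C (f (Pi.single m 1)) * MvPolynomial.X m
  map_add' f g := by simp [add_mul, Finset.sum_add_distrib]
  map_smul' a f := by simp [Finset.smul_sum, MvPolynomial.smul_eq_C_mul, mul_assoc]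

@[simp] lemma eval_linForm (f : Module.Dual k (Fin n → k)) (w : Fin n → k) :
    MvPolynomial.eval w (linForm f) = f w := by
  simp only [linForm, LinearMap.coe_mk, AddHom.coe_mk, map_sum, map_mul, MvPolynomial.eval_C,
    MvPolynomial.eval_X]
  conv_rhs => rw [LinearMap.pi_apply_eq_sum_univ f w]
  exact Finset.sum_congr rfl fun i _ => by rw [smul_eq_mul, mul_comm]; congr 3; ext j; simp [Pi.single_apply, eq_comm]

lemma linForm_proj (m : Fin n) : linForm (LinearMap.proj m : Module.Dual k (Fin n → k)) =
    MvPolynomial.X m := by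
  simp only [linForm, LinearMap.coe_mk, AddHom.coe_mk, LinearMap.proj_apply]
  rw [Finset.sum_eq_single m] <;> simp +contextual [eq_comm]

lemma eval_aeval (g : Fin n → Polynomial k) (F : MvPolynomial (Fin n) k) (t : k) :
    (MvPolynomial.aeval g F).eval t = MvPolynomial.eval (fun m => (g m).eval t) F := by
  induction F using MvPolynomial.induction_on with
  | C a => simp
  | add p q hp hq => simp [hp, hq]
  | mul_X p i hp => simp [hp]

end LinForm

/-! ### Homogeneous coordinate ring of a scroll. -/

section ScrollRing

variable {k : Type*} [Field k] {r l v : ℕ} {d : Fin l → ℕ}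
  (b : Module.Basis ((Σ i : Fin l, Fin (d i + 1)) ⊕ Fin v) k (Fin (r + 1) → k))

lemma mem_affineCone_scrollCone (hl : 1 ≤ l) {x : Fin (r + 1) → k} :
    x ∈ affineCone (scrollCone b) ↔ ∃ q : Fin 2 → k, q ≠ 0 ∧ x ∈ rulingSpace b q := by
  constructor
  · rintro ⟨y, ⟨q, hq, hy⟩, hx⟩
    exact ⟨q, hq, hy hx⟩
  · rintro ⟨q, hq, hx⟩
    by_cases h0 : x = 0
    · let i₀ : Fin l := ⟨0, hl⟩
      refine ⟨Projectivization.mk k (b (Sum.inl ⟨i₀, 0⟩)) (b.ne_zero _),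
        ⟨![1, 0], fun h => by simpa using congrFun h 0, ?_⟩, h0 ▸ Submodule.zero_mem _⟩
      rw [Projectivization.submodule_mk, Submodule.span_singleton_le_iff_mem, rulingSpace_eq_ker b
        (fun h => by simpa using congrFun h 0), mem_ker_scrollPencil]
      intro i j
      simp only [Matrix.cons_val_one, Matrix.cons_val_zero, zero_mul, one_mul,
        Module.Basis.repr_self]
      rw [Finsupp.single_eq_of_ne]
      intro h
      rw [Sum.inl.injEq, Sigma.mk.injEq] at h
      obtain ⟨rfl, h⟩ := h
      exact absurd (eq_of_heq h) (Fin.succ_ne_zero j)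
    · refine ⟨Projectivization.mk k x h0, ⟨q, hq, ?_⟩, ?_⟩
      · rwa [Projectivization.submodule_mk, Submodule.span_singleton_le_iff_mem]
      · rw [Projectivization.submodule_mk]
        exact Submodule.mem_span_singleton_self x

/-- The monomials which parametrize the affine cone over the scroll. -/
def scrollMonomial : (Σ i : Fin l, Fin (d i + 1)) ⊕ Fin v →
    MvPolynomial (Option (Fin l ⊕ Fin v)) k :=
  Sum.elim (fun x => MvPolynomial.X (some (Sum.inl x.1)) * MvPolynomial.X none ^ (x.2 : ℕ))
    fun j => MvPolynomial.X (some (Sum.inr j))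

/-- The homomorphism dual to the parametrization of the affine cone over the scroll. -/
def scrollParam : MvPolynomial (Fin (r + 1)) k →ₐ[k] MvPolynomial (Option (Fin l ⊕ Fin v)) k :=
  MvPolynomial.aeval fun m => ∑ x, MvPolynomial.C (b x m) * scrollMonomial x

lemma eval_scrollParam (a : Option (Fin l ⊕ Fin v) → k) (F : MvPolynomial (Fin (r + 1)) k) :
    MvPolynomial.eval a (scrollParam b F) =
      MvPolynomial.eval (∑ x, MvPolynomial.eval a (scrollMonomial x) • b x) F := by
  induction F using MvPolynomial.induction_on with
  | C a => simp [scrollParam]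
  | add p q hp hq => simp [hp, hq]
  | mul_X p i hp =>
    rw [map_mul, map_mul, map_mul, hp, MvPolynomial.eval_X]
    congr 1
    simp [scrollParam, mul_comm]

lemma sum_scrollMonomial_mem (a : Option (Fin l ⊕ Fin v) → k) :
    ∑ x, MvPolynomial.eval a (scrollMonomial x) • b x ∈ rulingSpace b ![1, a none] := by
  rw [rulingSpace_eq_ker b (fun h => by simpa using congrFun h 0), mem_ker_scrollPencil]
  intro i j
  rw [b.repr_sum_self]
  simp [scrollMonomial, pow_succ]
  ring

lemma exists_eq_sum_scrollMonomial {q : Fin 2 → k} (hq : q 0 ≠ 0) {x : Fin (r + 1) → k}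
    (hx : x ∈ rulingSpace b q) :
    ∃ a : Option (Fin l ⊕ Fin v) → k, x = ∑ y, MvPolynomial.eval a (scrollMonomial y) • b y := by
  have hq' : q ≠ 0 := fun h => hq (congrFun h 0)
  rw [rulingSpace_eq_ker b hq', mem_ker_scrollPencil] at hx
  refine ⟨fun o => o.elim (q 1 / q 0) (Sum.elim (fun i => b.repr x (Sum.inl ⟨i, 0⟩))
    fun j => b.repr x (Sum.inr j)), ?_⟩
  conv_lhs => rw [← b.sum_repr x]
  refine Finset.sum_congr rfl fun y _ => ?_
  congr 1
  rcases y with ⟨i, j⟩ | j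
  · simp only [scrollMonomial, Sum.elim_inl, map_mul, MvPolynomial.eval_X, map_pow, Option.elim]
    obtain ⟨c, hc⟩ := exists_eq_mul_pow (x := fun j => b.repr x (Sum.inl ⟨i, j⟩)) hq' (hx i)
    have e1 := hc j
    have e2 := hc 0
    simp only [Fin.val_zero, Nat.sub_zero, pow_zero, mul_one] at e1 e2
    rw [e1, e2]
    have : q 0 ^ d i = q 0 ^ (d i - (j : ℕ)) * q 0 ^ (j : ℕ) := by
      rw [← pow_add]; congr 1; omega
    rw [this, div_pow]
    field_simp
  · simp [scrollMonomial]

/-- The parametrization covers the rulings with `q 0 ≠ 0`; a polynomial vanishing on these vanishes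
on the remaining ruling by specialization. -/
lemma projIdeal_scrollCone [Infinite k] (hl : 1 ≤ l) :
    projIdeal (scrollCone b) = RingHom.ker (scrollParam b) := by
  ext F
  rw [projIdeal, MvPolynomial.mem_vanishingIdeal_iff, RingHom.mem_ker]
  simp only [MvPolynomial.aeval_eq_eval]
  constructor
  · intro h
    apply MvPolynomial.funext
    intro a
    rw [eval_scrollParam, map_zero]
    apply h
    rw [mem_affineCone_scrollCone b hl]
    exact ⟨_, fun h => by simpa using congrFun h 0, sum_scrollMonomial_mem b a⟩
  · intro h x hx
    have hne : ∀ q : Fin 2 → k, q 0 ≠ 0 → ∀ x ∈ rulingSpace b q, MvPolynomial.eval x F = 0 := by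
      intro q hq x hx
      obtain ⟨a, rfl⟩ := exists_eq_sum_scrollMonomial b hq hx
      rw [← eval_scrollParam, h, map_zero]
    rw [mem_affineCone_scrollCone b hl] at hx
    obtain ⟨q, hq, hx⟩ := hx
    rw [rulingSpace_eq_ker b hq, mem_ker_scrollPencil] at hx
    have := fun i => exists_eq_mul_pow (x := fun j => b.repr x (Sum.inl ⟨i, j⟩)) hq (hx i)
    choose c hc using this
    -- The coordinates of a curve in the cone with the parameter `(ε, q 1)` and fixed coefficients
    -- `c`; it passes through `x` at `ε = q 0`. The polynomial `G` vanishes for all `ε ≠ 0`, hence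
    -- identically.
    let M : (Σ i : Fin l, Fin (d i + 1)) ⊕ Fin v → Polynomial k := Sum.elim
      (fun y => Polynomial.C (c y.1 * q 1 ^ (y.2 : ℕ)) * Polynomial.X ^ (d y.1 - (y.2 : ℕ)))
      fun j => Polynomial.C (b.repr x (Sum.inr j))
    let G : Polynomial k := MvPolynomial.aeval (fun m => ∑ y, Polynomial.C (b y m) * M y) F
    have hMl : ∀ i j ε, (M (Sum.inl ⟨i, j⟩)).eval ε =
        c i * q 1 ^ (j : ℕ) * ε ^ (d i - (j : ℕ)) := fun i j ε => by simp [M]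
    have hMr : ∀ j ε, (M (Sum.inr j)).eval ε = b.repr x (Sum.inr j) := fun j ε => by simp [M]
    have hG : ∀ ε, G.eval ε = MvPolynomial.eval (∑ y, (M y).eval ε • b y) F := by
      intro ε
      rw [eval_aeval]
      congr 2
      ext m
      rw [Polynomial.eval_finsetSum]
      simp only [Finset.sum_apply, Pi.smul_apply, smul_eq_mul, Polynomial.eval_mul,
        Polynomial.eval_C]
      exact Finset.sum_congr rfl fun _ _ => mul_comm _ _
    have hroot : ∀ ε, ε ≠ 0 → G.eval ε = 0 := by
      intro ε hε
      rw [hG]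
      refine hne ![ε, q 1] hε _ ?_
      rw [rulingSpace_eq_ker b (fun h => hε (by simpa using congrFun h 0)), mem_ker_scrollPencil]
      intro i j
      rw [b.repr_sum_self]
      have : d i - (j : ℕ) = (d i - ((j : ℕ) + 1)) + 1 := by omega
      simp only [hMl, Fin.val_castSucc, Fin.val_succ, this, Matrix.cons_val_one,
        Matrix.cons_val_zero]
      ring
    have hG0 : G = 0 := by
      apply Polynomial.eq_zero_of_infinite_isRoot
      refine Set.Infinite.mono (s := {0}ᶜ) (fun ε hε => hroot ε hε) ?_
      exact Set.Finite.infinite_compl (Set.finite_singleton 0)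
    have hx' : ∑ y, (M y).eval (q 0) • b y = x := by
      conv_rhs => rw [← b.sum_repr x]
      refine Finset.sum_congr rfl fun y _ => ?_
      rcases y with ⟨i, j⟩ | j
      · rw [hMl, hc i j, mul_assoc, mul_comm (q 1 ^ _)]
      · rw [hMr]
    rw [← hx', ← hG, hG0, Polynomial.eval_zero]

lemma scrollParam_linForm_coord [Infinite k] (x) :
    scrollParam b (linForm (b.coord x)) = scrollMonomial x := by
  apply MvPolynomial.funext
  intro a
  rw [eval_scrollParam, eval_linForm, Module.Basis.coord_apply, b.repr_sum_self]

lemma isDomain_coordRing_scrollCone [Infinite k] (hl : 1 ≤ l) :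
    IsDomain (coordRing (scrollCone b)) := by
  change IsDomain (CoordPoly k r ⧸ projIdeal (scrollCone b))
  rw [projIdeal_scrollCone b hl]
  have := RingHom.ker_isPrime (scrollParam b)
  infer_instance

theorem ringKrullDim_coordRing_scrollCone [Infinite k] (hl : 1 ≤ l) (hd : ∀ i, 1 ≤ d i) :
    ringKrullDim (coordRing (scrollCone b)) = (l + v + 1 : ℕ) := by
  change ringKrullDim (CoordPoly k r ⧸ projIdeal (scrollCone b)) = _
  rw [projIdeal_scrollCone b hl]
  have := ringKrullDim_eq_card_of_isAlgebraic (Ideal.kerLiftAlg (scrollParam b))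
    (Ideal.kerLiftAlg_injective _) ?_
  · rw [this]; simp
  have hf : ∀ x, Ideal.kerLiftAlg (scrollParam b)
      (Ideal.Quotient.mk _ (linForm (b.coord x))) = scrollMonomial x := fun x => by
    rw [Ideal.kerLiftAlg_mk, scrollParam_linForm_coord]
  rintro (_ | i | j)
  -- The curve parameter is the quotient of the second and first coordinates of one block; the
  -- second exists because `d i₀ ≥ 1`.
  · let i₀ : Fin l := ⟨0, hl⟩
    refine ⟨_, _, ?_, (congrArg₂ (· * ·) (hf (Sum.inl ⟨i₀, 0⟩)) rfl).trans
      (Eq.trans ?_ (hf (Sum.inl ⟨i₀, ⟨1, by have := hd i₀; omega⟩⟩)).symm)⟩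
    · rw [hf]
      simp [scrollMonomial]
    · simp [scrollMonomial]
  · refine ⟨1, _, by simp, Eq.trans ?_ (hf (Sum.inl ⟨i, 0⟩)).symm⟩
    simp [scrollMonomial]
  · refine ⟨1, _, by simp, Eq.trans ?_ (hf (Sum.inr j)).symm⟩
    simp [scrollMonomial]

/-- Along the `i`-th curve, `f` is a polynomial in `t` with coefficients the values of `f` on the
basis of that block; having infinitely many roots, it is zero. -/
lemma eq_zero_of_forall_affineCone_scrollCone [Infinite k] (hl : 1 ≤ l)
    {f : Module.Dual k (Fin (r + 1) → k)}
    (hf : ∀ x ∈ affineCone (scrollCone b), f x = 0) : f = 0 := by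
  refine b.ext ?_
  rintro (⟨i, j⟩ | j)
  · let G : Polynomial k := ∑ j : Fin (d i + 1),
      Polynomial.C (f (b (Sum.inl ⟨i, j⟩))) * Polynomial.X ^ (j : ℕ)
    have hG : G = 0 := by
      apply Polynomial.eq_zero_of_infinite_isRoot
      convert! Set.infinite_univ (α := k)
      refine Set.eq_univ_of_forall fun t => ?_
      have := hf (curvePoint b i ![1, t]) ((mem_affineCone_scrollCone b hl).2
        ⟨![1, t], fun h => by simpa using congrFun h 0,
          Submodule.mem_sup_left (Submodule.subset_span ⟨i, rfl⟩)⟩)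
      simp [curvePoint] at this
      change G.eval t = 0
      simp [G, Polynomial.eval_finsetSum]
      rw [← this]
      exact Finset.sum_congr rfl fun _ _ => mul_comm _ _
    have := congrArg (fun p => p.coeff (j : ℕ)) hG
    simp only [G, Polynomial.finsetSum_coeff, Polynomial.coeff_C_mul_X_pow,
      Polynomial.coeff_zero] at this
    rw [Finset.sum_eq_single j] at this
    · simpa using this
    · intro j' _ hj'
      rw [if_neg]
      exact fun h => hj' (Fin.ext h.symm)
    · simp
  · refine hf _ ((mem_affineCone_scrollCone b hl).2 ⟨![1, 0], fun h => by simpa using congrFun h 0,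
      Submodule.mem_sup_right (Submodule.subset_span ⟨j, rfl⟩)⟩)

end ScrollRing

/-! ### Substitution along a linear map and first-order coefficients. -/

section Pullback

variable {k : Type*} [Field k] {m n : ℕ}

/-- The substitution homomorphism dual to the linear map `π`. -/
def linPullback (π : (Fin m → k) →ₗ[k] (Fin n → k)) :
    MvPolynomial (Fin n) k →ₐ[k] MvPolynomial (Fin m) k :=
  MvPolynomial.aeval fun i => linForm (LinearMap.proj i ∘ₗ π)

lemma eval_linPullback (π : (Fin m → k) →ₗ[k] (Fin n → k)) (w : Fin m → k)
    (F : MvPolynomial (Fin n) k) :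
    MvPolynomial.eval w (linPullback π F) = MvPolynomial.eval (π w) F := by
  induction F using MvPolynomial.induction_on with
  | C a => simp [linPullback]
  | add p q hp hq => simp [hp, hq]
  | mul_X p i hp =>
    rw [map_mul, map_mul, map_mul, hp]
    simp [linPullback]

/-- The coefficient of `τ` in `F (τ x)` is a linear function of `x`. -/
lemma exists_coeff_one_eq (F : MvPolynomial (Fin n) k) : ∃ μ : Module.Dual k (Fin n → k), ∀ x,
    (MvPolynomial.aeval (fun i => Polynomial.C (x i) * Polynomial.X) F : Polynomial k).coeff 1 =
      μ x := by
  induction F using MvPolynomial.induction_on with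
  | C a => exact ⟨0, fun x => by simp⟩
  | add p q hp hq =>
    obtain ⟨μ, hμ⟩ := hp
    obtain ⟨ν, hν⟩ := hq
    exact ⟨μ + ν, fun x => by simp [hμ, hν]⟩
  | mul_X p i hp =>
    refine ⟨MvPolynomial.eval 0 p • LinearMap.proj i, fun x => ?_⟩
    rw [map_mul, MvPolynomial.aeval_X, ← mul_assoc, Polynomial.coeff_mul_X, Polynomial.coeff_mul_C,
      Polynomial.coeff_zero_eq_eval_zero, eval_aeval]
    simp

lemma coeff_zero_aeval (F : MvPolynomial (Fin n) k) (x : Fin n → k) :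
    (MvPolynomial.aeval (fun i => Polynomial.C (x i) * Polynomial.X) F : Polynomial k).coeff 0 =
      MvPolynomial.eval 0 F := by
  rw [Polynomial.coeff_zero_eq_eval_zero, eval_aeval]
  simp

lemma sub_C_eval_zero_mem (F : MvPolynomial (Fin n) k) :
    F - MvPolynomial.C (MvPolynomial.eval 0 F) ∈
      Ideal.span (Set.range (MvPolynomial.X : Fin n → MvPolynomial (Fin n) k)) := by
  induction F using MvPolynomial.induction_on with
  | C a => simp
  | add p q hp hq =>
    rw [map_add, map_add, add_sub_add_comm]
    exact Ideal.add_mem _ hp hq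
  | mul_X p i hp =>
    simp only [map_mul, MvPolynomial.eval_X, Pi.zero_apply, mul_zero, map_zero, sub_zero]
    exact Ideal.mul_mem_left _ _ (Ideal.subset_span ⟨i, rfl⟩)

end Pullback

/-! ### Coordinate rings under linear projection. -/

section Projection

variable {k : Type*} [Field k] {s r : ℕ}

lemma mem_projIdeal {X : Set (PSpace k r)} {F : CoordPoly k r} :
    F ∈ projIdeal X ↔ ∀ x ∈ affineCone X, MvPolynomial.eval x F = 0 := by
  rw [projIdeal, MvPolynomial.mem_vanishingIdeal_iff]
  simp only [MvPolynomial.aeval_eq_eval]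

variable (π : (Fin (s + 1) → k) →ₗ[k] (Fin (r + 1) → k))

lemma affineCone_projImage {X : Set (PSpace k s)} (hX : ∀ x ∈ X, ¬ x.submodule ≤ LinearMap.ker π) :
    affineCone (projImage π X) = π '' affineCone X := by
  ext y
  constructor
  · rintro ⟨y', ⟨x, hx, hy'⟩, hy⟩
    rw [hy'] at hy
    obtain ⟨w, hw, rfl⟩ := hy
    exact ⟨w, ⟨x, hx, hw⟩, rfl⟩
  · rintro ⟨w, ⟨x, hx, hw⟩, rfl⟩
    have hne : π x.rep ≠ 0 := fun h0 => hX x hx (by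
      rw [Projectivization.submodule_eq, Submodule.span_singleton_le_iff_mem]
      exact h0)
    have hsub : (Projectivization.mk k (π x.rep) hne).submodule = x.submodule.map π := by
      rw [Projectivization.submodule_mk, Projectivization.submodule_eq, Submodule.map_span,
        Set.image_singleton]
    exact ⟨_, ⟨x, hx, hsub⟩, hsub ▸ Submodule.mem_map_of_mem hw⟩

lemma projIdeal_projImage {X : Set (PSpace k s)}
    (hX : ∀ x ∈ X, ¬ x.submodule ≤ LinearMap.ker π) :
    projIdeal (projImage π X) = (projIdeal X).comap (linPullback π) := by
  ext F
  rw [Ideal.mem_comap, mem_projIdeal, mem_projIdeal, affineCone_projImage π hX]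
  simp [eval_linPullback]

/-- The inclusion of homogeneous coordinate rings dual to a linear projection. -/
def coordMap {X : Set (PSpace k s)} (hX : ∀ x ∈ X, ¬ x.submodule ≤ LinearMap.ker π) :
    coordRing (projImage π X) →+* coordRing X :=
  Ideal.quotientMap _ (linPullback π : CoordPoly k r →+* CoordPoly k s)
    (projIdeal_projImage π hX).le

variable {X : Set (PSpace k s)} (hX : ∀ x ∈ X, ¬ x.submodule ≤ LinearMap.ker π)

lemma coordMap_injective : Function.Injective (coordMap π hX) :=
  Ideal.quotientMap_injective' (projIdeal_projImage π hX).ge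

lemma coordMap_mk (F : CoordPoly k r) :
    coordMap π hX (Ideal.Quotient.mk _ F) = Ideal.Quotient.mk _ (linPullback π F) := rfl

lemma mk_eq_mk_iff_forall {F G : CoordPoly k s} :
    Ideal.Quotient.mk (projIdeal X) F = Ideal.Quotient.mk (projIdeal X) G ↔
      ∀ x ∈ affineCone X, MvPolynomial.eval x F = MvPolynomial.eval x G := by
  rw [Ideal.Quotient.eq, mem_projIdeal]
  simp [sub_eq_zero]

/-- If the centre of the projection is a point and the missing coordinate `ζ` satisfies a monic
quadratic equation on `X`, then the dimension of `X` is preserved. -/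
lemma ringKrullDim_projImage (hX : ∀ x ∈ X, ¬ x.submodule ≤ LinearMap.ker π)
    {σ : (Fin (r + 1) → k) →ₗ[k] (Fin (s + 1) → k)} {p : Fin (s + 1) → k}
    {ζ : Module.Dual k (Fin (s + 1) → k)} (hσ : ∀ w, w = σ (π w) + ζ w • p) {F G : CoordPoly k r}
    (hFG : ∀ w ∈ affineCone X,
      ζ w ^ 2 + MvPolynomial.eval (π w) F * ζ w + MvPolynomial.eval (π w) G = 0) :
    ringKrullDim (coordRing (projImage π X)) = ringKrullDim (coordRing X) := by
  let _ := (coordMap π hX).toAlgebra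
  have halg : ∀ F, algebraMap (coordRing (projImage π X)) (coordRing X) (Ideal.Quotient.mk _ F) =
    Ideal.Quotient.mk _ (linPullback π F) := coordMap_mk π hX
  have hζ : IsIntegral (coordRing (projImage π X)) (Ideal.Quotient.mk (projIdeal X) (linForm ζ)) := by
    refine ⟨Polynomial.X ^ 2 + (Polynomial.C (Ideal.Quotient.mk _ F) * Polynomial.X +
      Polynomial.C (Ideal.Quotient.mk _ G)), ?_, ?_⟩
    · refine Polynomial.monic_X_pow_add ?_
      exact (Polynomial.degree_linear_le).trans_lt (by norm_num)
    · simp only [Polynomial.eval₂_add, Polynomial.eval₂_pow, Polynomial.eval₂_X,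
        Polynomial.eval₂_mul, Polynomial.eval₂_C, halg]
      rw [← map_pow, ← map_mul, ← map_add, ← map_add, ← map_zero (Ideal.Quotient.mk _),
        mk_eq_mk_iff_forall]
      intro w hw
      simp only [map_add, map_pow, map_mul, eval_linForm, eval_linPullback, map_zero]
      rw [← hFG w hw]
      ring
  -- By `hσ`, every linear form is a form pulled back along `π` plus a constant multiple of `ζ`.
  have hlin : ∀ f : Module.Dual k (Fin (s + 1) → k), IsIntegral (coordRing (projImage π X))
      (Ideal.Quotient.mk (projIdeal X) (linForm f)) := by
    intro f
    have : Ideal.Quotient.mk (projIdeal X) (linForm f) =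
        algebraMap (coordRing (projImage π X)) (coordRing X)
          (Ideal.Quotient.mk _ (linForm (f ∘ₗ σ))) +
        algebraMap (coordRing (projImage π X)) (coordRing X)
          (Ideal.Quotient.mk _ (MvPolynomial.C (f p))) *
        Ideal.Quotient.mk (projIdeal X) (linForm ζ) := by
      rw [halg, halg, ← map_mul, ← map_add, mk_eq_mk_iff_forall]
      intro w _
      simp only [map_add, map_mul, eval_linForm, eval_linPullback, MvPolynomial.eval_C]
      conv_lhs => rw [hσ w]
      simp [mul_comm]
    rw [this]
    exact isIntegral_algebraMap.add (isIntegral_algebraMap.mul hζ)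
  have : Algebra.IsIntegral (coordRing (projImage π X)) (coordRing X) := by
    refine ⟨fun a => ?_⟩
    obtain ⟨H, rfl⟩ := Ideal.Quotient.mk_surjective a
    induction H using MvPolynomial.induction_on with
    | C a =>
      have : Ideal.Quotient.mk (projIdeal X) (MvPolynomial.C a) =
          algebraMap (coordRing (projImage π X)) (coordRing X)
            (Ideal.Quotient.mk _ (MvPolynomial.C a)) := by
        rw [halg]
        simp [linPullback]
      rw [this]
      exact isIntegral_algebraMap
    | add p q hp hq => rw [map_add]; exact hp.add hq
    | mul_X p i hp =>
      rw [map_mul, ← linForm_proj]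
      exact hp.mul (hlin _)
  exact ringKrullDim_eq_of_isIntegral (coordMap_injective π hX)

end Projection

/-! ### Pairs of vectors. -/

section LinearAlgebra

variable {k : Type*} [Field k]

lemma exists_dual_pair {U : Type*} [AddCommGroup U] [Module k U] {x y : U}
    (h : LinearIndependent k ![x, y]) :
    ∃ α β : Module.Dual k U, α x = 1 ∧ α y = 0 ∧ β x = 0 ∧ β y = 1 := by
  obtain ⟨g, hg⟩ := (Fintype.linearCombination k ![x, y]).exists_leftInverse_of_injective
    (LinearMap.ker_eq_bot.2 (linearIndependent_iff_injective_fintypeLinearCombination.1 h))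
  have hx : g x = Pi.single 0 1 := by
    have := LinearMap.congr_fun hg (Pi.single 0 1)
    simpa [Fintype.linearCombination_apply] using this
  have hy : g y = Pi.single 1 1 := by
    have := LinearMap.congr_fun hg (Pi.single 1 1)
    simpa [Fintype.linearCombination_apply] using this
  exact ⟨LinearMap.proj 0 ∘ₗ g, LinearMap.proj 1 ∘ₗ g, by simp [hx], by simp [hy], by simp [hx],
    by simp [hy]⟩

lemma linearIndependent_pair_of_forall {V U : Type*} [AddCommGroup V] [Module k V] [AddCommGroup U]
    [Module k U] {A B : V →ₗ[k] U} {p : V}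
    (h : ∀ q : Fin 2 → k, q ≠ 0 → p ∉ LinearMap.ker (q 1 • A - q 0 • B)) :
    LinearIndependent k ![A p, B p] := by
  rw [LinearIndependent.pair_iff]
  intro s t hst
  by_contra hne
  refine h ![-t, s] (fun h0 => hne ?_) ?_
  · exact ⟨by simpa using congrFun h0 1, by simpa using congrFun h0 0⟩
  · simpa using hst

lemma exists_ne_zero_mem_ker_of_mul_eq {a b : Fin 2 → k} (h : a 0 * b 1 = b 0 * a 1) :
    ∃ q : Fin 2 → k, q ≠ 0 ∧ q 1 • a = q 0 • b := by
  by_cases h0 : a 0 = 0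
  · by_cases h1 : a 1 = 0
    · refine ⟨![0, 1], fun h => by simpa using congrFun h 1, ?_⟩
      ext i
      fin_cases i <;> simp [h0, h1]
    · refine ⟨![a 1, b 1], fun h => h1 (by simpa using congrFun h 0), ?_⟩
      ext i
      fin_cases i
      · simpa [mul_comm] using h
      · exact mul_comm _ _
  · refine ⟨![a 0, b 0], fun h => h0 (by simpa using congrFun h 0), ?_⟩
    ext i
    fin_cases i
    · exact mul_comm _ _
    · simpa using h.symm

end LinearAlgebra

/-! ### The pencil induced on the target of the projection. -/

section ScrollProjection

variable {k : Type*} [Field k] {r l v : ℕ} {d : Fin l → ℕ}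

/-- The projection `π` of a scroll from the point `p` which is not on the scroll, with a linear
section `σ` of `π` and the coordinate `ζ` along `p`. -/
structure IsScrollProjection
    (b : Module.Basis ((Σ i : Fin l, Fin (d i + 1)) ⊕ Fin v) k (Fin (r + 1 + 1) → k))
    (π : (Fin (r + 1 + 1) → k) →ₗ[k] (Fin (r + 1) → k))
    (σ : (Fin (r + 1) → k) →ₗ[k] (Fin (r + 1 + 1) → k)) (p : Fin (r + 1 + 1) → k)
    (ζ : Module.Dual k (Fin (r + 1 + 1) → k)) : Prop where
  one_le : 1 ≤ l
  one_le_apply : ∀ i, 1 ≤ d i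
  notMem : ∀ q : Fin 2 → k, q ≠ 0 → p ∉ rulingSpace b q
  map_section : ∀ u, π (σ u) = u
  map_center : π p = 0
  eq_add : ∀ w, w = σ (π w) + ζ w • p
  coord_center : ζ p = 1

/-- The span of the two columns of the matrix of the scroll at the point `p`. -/
def centerSpan (b : Module.Basis ((Σ i : Fin l, Fin (d i + 1)) ⊕ Fin v) k (Fin (r + 1 + 1) → k))
    (p : Fin (r + 1 + 1) → k) : Submodule k ((Σ i : Fin l, Fin (d i)) → k) :=
  Submodule.span k {scrollLeft b p, scrollRight b p}

/-- The first row of the matrix of the scroll, modulo its values at the centre. -/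
def projLeft (b : Module.Basis ((Σ i : Fin l, Fin (d i + 1)) ⊕ Fin v) k (Fin (r + 1 + 1) → k))
    (σ : (Fin (r + 1) → k) →ₗ[k] (Fin (r + 1 + 1) → k)) (p : Fin (r + 1 + 1) → k) :
    (Fin (r + 1) → k) →ₗ[k] (((Σ i : Fin l, Fin (d i)) → k) ⧸ centerSpan b p) :=
  (centerSpan b p).mkQ ∘ₗ scrollLeft b ∘ₗ σ

/-- The second row of the matrix of the scroll, modulo its values at the centre. -/
def projRight (b : Module.Basis ((Σ i : Fin l, Fin (d i + 1)) ⊕ Fin v) k (Fin (r + 1 + 1) → k))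
    (σ : (Fin (r + 1) → k) →ₗ[k] (Fin (r + 1 + 1) → k)) (p : Fin (r + 1 + 1) → k) :
    (Fin (r + 1) → k) →ₗ[k] (((Σ i : Fin l, Fin (d i)) → k) ⧸ centerSpan b p) :=
  (centerSpan b p).mkQ ∘ₗ scrollRight b ∘ₗ σ

/-- On a ruling the two rows are proportional, so every `2 × 2` minor vanishes, in whatever basis of
the columns. All quadratic relations below are instances of this one. -/
lemma mul_eq_mul_of_mem_affineCone
    {b : Module.Basis ((Σ i : Fin l, Fin (d i + 1)) ⊕ Fin v) k (Fin (r + 1) → k)} (hl : 1 ≤ l)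
    {x : Fin (r + 1) → k} (hx : x ∈ affineCone (scrollCone b))
    (φ ψ : Module.Dual k ((Σ i : Fin l, Fin (d i)) → k)) :
    φ (scrollLeft b x) * ψ (scrollRight b x) = φ (scrollRight b x) * ψ (scrollLeft b x) := by
  obtain ⟨q, hq, hxq⟩ := (mem_affineCone_scrollCone b hl).1 hx
  rw [rulingSpace_eq_ker b hq, LinearMap.mem_ker, LinearMap.sub_apply, sub_eq_zero] at hxq
  have h1 := congrArg φ hxq
  have h2 := congrArg ψ hxq
  simp only [LinearMap.smul_apply, map_smul, smul_eq_mul] at h1 h2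
  have e0 : q 0 * (φ (scrollLeft b x) * ψ (scrollRight b x)) =
      q 0 * (φ (scrollRight b x) * ψ (scrollLeft b x)) := by
    linear_combination ψ (scrollLeft b x) * h1 - φ (scrollLeft b x) * h2
  have e1 : q 1 * (φ (scrollLeft b x) * ψ (scrollRight b x)) =
      q 1 * (φ (scrollRight b x) * ψ (scrollLeft b x)) := by
    linear_combination ψ (scrollRight b x) * h1 - φ (scrollRight b x) * h2
  by_cases h0 : q 0 = 0
  · refine mul_left_cancel₀ (fun h1 => hq ?_) e1
    ext i
    fin_cases i
    · exact h0
    · exact h1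
  · exact mul_left_cancel₀ h0 e0

namespace IsScrollProjection

variable {b : Module.Basis ((Σ i : Fin l, Fin (d i + 1)) ⊕ Fin v) k (Fin (r + 1 + 1) → k)}
  {π : (Fin (r + 1 + 1) → k) →ₗ[k] (Fin (r + 1) → k)}
  {σ : (Fin (r + 1) → k) →ₗ[k] (Fin (r + 1 + 1) → k)} {p : Fin (r + 1 + 1) → k}
  {ζ : Module.Dual k (Fin (r + 1 + 1) → k)}

lemma linearIndependent (h : IsScrollProjection b π σ p ζ) :
    LinearIndependent k ![scrollLeft b p, scrollRight b p] :=
  linearIndependent_pair_of_forall fun q hq => by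
    rw [← rulingSpace_eq_ker b hq]; exact h.notMem q hq

lemma finrank_centerSpan (h : IsScrollProjection b π σ p ζ) :
    Module.finrank k (centerSpan b p) = 2 := by
  have e : ({scrollLeft b p, scrollRight b p} : Set _) =
      Set.range ![scrollLeft b p, scrollRight b p] := by
    rw [Matrix.range_cons, Matrix.range_cons, Matrix.range_empty, Set.union_empty,
      Set.singleton_union]
  rw [centerSpan, e]
  exact (finrank_span_eq_card h.linearIndependent).trans (by simp)

lemma finrank_quotient (h : IsScrollProjection b π σ p ζ) :
    Module.finrank k (((Σ i : Fin l, Fin (d i)) → k) ⧸ centerSpan b p) + 2 = ∑ i, d i := by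
  have := Submodule.finrank_quotient_add_finrank (centerSpan b p)
  rw [h.finrank_centerSpan, Module.finrank_fintype_fun_eq_card] at this
  simpa using this

lemma finrank_ambient (_h : IsScrollProjection b π σ p ζ) : r + 2 = ∑ i, d i + l + v := by
  rw [← finrank_eq_of_scrollBasis b]
  simp

lemma mem_ker_iff (h : IsScrollProjection b π σ p ζ) {w : Fin (r + 1 + 1) → k} :
    π w = 0 ↔ ∃ c : k, w = c • p := by
  constructor
  · intro hw
    have := h.eq_add w
    rw [hw, map_zero, zero_add] at this
    exact ⟨_, this⟩
  · rintro ⟨c, rfl⟩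
    rw [map_smul, h.map_center, smul_zero]

lemma not_le_ker (h : IsScrollProjection b π σ p ζ) :
    ∀ x ∈ scrollCone b, ¬ x.submodule ≤ LinearMap.ker π := by
  rintro x ⟨q, hq, hx⟩ hle
  rw [Projectivization.submodule_eq, Submodule.span_singleton_le_iff_mem] at hx hle
  obtain ⟨c, hc⟩ := h.mem_ker_iff.1 hle
  have hc0 : c ≠ 0 := by
    rintro rfl
    exact x.rep_nonzero (by rw [hc, zero_smul])
  rw [hc, Submodule.smul_mem_iff _ hc0] at hx
  exact h.notMem q hq hx

lemma projLeft_apply (h : IsScrollProjection b π σ p ζ) (w : Fin (r + 1 + 1) → k) :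
    projLeft b σ p (π w) = (centerSpan b p).mkQ (scrollLeft b w) := by
  conv_rhs => rw [h.eq_add w]
  have : (centerSpan b p).mkQ (scrollLeft b p) = 0 := by
    rw [Submodule.mkQ_apply, Submodule.Quotient.mk_eq_zero]
    exact Submodule.subset_span (by simp)
  rw [map_add, map_smul, map_add, map_smul, this, smul_zero, add_zero]
  rfl

lemma projRight_apply (h : IsScrollProjection b π σ p ζ) (w : Fin (r + 1 + 1) → k) :
    projRight b σ p (π w) = (centerSpan b p).mkQ (scrollRight b w) := by
  conv_rhs => rw [h.eq_add w]
  have : (centerSpan b p).mkQ (scrollRight b p) = 0 := by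
    rw [Submodule.mkQ_apply, Submodule.Quotient.mk_eq_zero]
    exact Submodule.subset_span (by simp)
  rw [map_add, map_smul, map_add, map_smul, this, smul_zero, add_zero]
  rfl

lemma pencil_apply (h : IsScrollProjection b π σ p ζ) (q : Fin 2 → k) (w : Fin (r + 1 + 1) → k) :
    (q 1 • projLeft b σ p - q 0 • projRight b σ p) (π w) =
      (centerSpan b p).mkQ ((q 1 • scrollLeft b - q 0 • scrollRight b) w) := by
  simp only [LinearMap.sub_apply, LinearMap.smul_apply, h.projLeft_apply, h.projRight_apply,
    map_sub, map_smul]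

lemma pencilSurjective (h : IsScrollProjection b π σ p ζ) :
    PencilSurjective (projLeft b σ p) (projRight b σ p) := by
  intro q hq y
  obtain ⟨u, rfl⟩ := Submodule.mkQ_surjective _ y
  obtain ⟨w, rfl⟩ := pencilSurjective_scroll b q hq u
  exact ⟨π w, h.pencil_apply q w⟩

lemma projImage_subset (h : IsScrollProjection b π σ p ζ) :
    projImage π (scrollCone b) ⊆ pencilLocus (projLeft b σ p) (projRight b σ p) := by
  rintro y ⟨x, ⟨q, hq, hx⟩, hy⟩
  refine ⟨q, hq, ?_⟩
  rw [hy, Submodule.map_le_iff_le_comap]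
  intro w hw
  have hw' := hx hw
  rw [rulingSpace_eq_ker b hq, LinearMap.mem_ker] at hw'
  rw [Submodule.mem_comap, LinearMap.mem_ker, h.pencil_apply, hw', map_zero]

lemma le_finrank_vertex (h : IsScrollProjection b π σ p ζ) :
    v ≤ Module.finrank k
      (LinearMap.ker (projLeft b σ p) ⊓ LinearMap.ker (projRight b σ p) : Submodule k _) := by
  have hinj : Function.Injective (π.domRestrict (vertexSpace b)) := by
    rw [← LinearMap.ker_eq_bot, LinearMap.ker_eq_bot']
    rintro ⟨w, hw⟩ hπ
    obtain ⟨c, rfl⟩ := h.mem_ker_iff.1 hπ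
    by_cases hc : c = 0
    · ext1; simp [hc]
    · rw [Submodule.smul_mem_iff _ hc] at hw
      exact absurd (Submodule.mem_sup_right hw)
        (h.notMem ![1, 0] fun h0 => by simpa using congrFun h0 0)
  refine (finrank_vertexSpace b).ge.trans ?_
  rw [← LinearMap.finrank_range_of_inj hinj]
  apply Submodule.finrank_mono
  rintro _ ⟨⟨w, hw⟩, rfl⟩
  rw [← ker_inf_ker_scroll b h.one_le_apply, Submodule.mem_inf] at hw
  rw [LinearMap.domRestrict_apply, Submodule.mem_inf, LinearMap.mem_ker, LinearMap.mem_ker,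
    h.projLeft_apply, h.projRight_apply, LinearMap.mem_ker.1 hw.1, LinearMap.mem_ker.1 hw.2,
    map_zero]
  exact ⟨rfl, rfl⟩

/-- The preimage `N` of the new vertex maps by both rows into the plane `centerSpan b p`, with
kernel inside the old vertex; so `dim N ≤ v + 4`, and `p ∈ N` is lost under `π`. -/
lemma finrank_vertex_le (h : IsScrollProjection b π σ p ζ) :
    Module.finrank k
      (LinearMap.ker (projLeft b σ p) ⊓ LinearMap.ker (projRight b σ p) : Submodule k _) ≤
      v + 3 := by
  set K := (LinearMap.ker (projLeft b σ p) ⊓ LinearMap.ker (projRight b σ p) : Submodule k _)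
  let N := K.comap π
  have hN : ∀ w ∈ N, scrollLeft b w ∈ centerSpan b p ∧ scrollRight b w ∈ centerSpan b p := by
    intro w hw
    have hw' : projLeft b σ p (π w) = 0 ∧ projRight b σ p (π w) = 0 := hw
    rwa [h.projLeft_apply, h.projRight_apply, Submodule.mkQ_apply, Submodule.mkQ_apply,
      Submodule.Quotient.mk_eq_zero, Submodule.Quotient.mk_eq_zero] at hw'
  have h1 : Module.finrank k K + 1 ≤ Module.finrank k N := by
    have e := LinearMap.finrank_range_add_finrank_ker (π.domRestrict N)
    rw [LinearMap.range_domRestrict, Submodule.map_comap_eq_of_surjective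
      (fun u => ⟨σ u, h.map_section u⟩)] at e
    have hpN : p ∈ N := by
      rw [Submodule.mem_comap, h.map_center]
      exact Submodule.zero_mem _
    have : 0 < Module.finrank k (LinearMap.ker (π.domRestrict N)) := by
      refine (Module.finrank_pos_iff_exists_ne_zero (R := k)
        (M := LinearMap.ker (π.domRestrict N))).2 ?_
      refine ⟨⟨⟨p, hpN⟩, h.map_center⟩, fun h0 => ?_⟩
      have hp0 : p = 0 := congrArg Subtype.val (congrArg Subtype.val h0)
      have := h.coord_center
      rw [hp0, map_zero] at this
      exact zero_ne_one this
    omega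
  let Θ : N →ₗ[k] (centerSpan b p × centerSpan b p) :=
    ((scrollLeft b).restrict fun w hw => (hN w hw).1).prod
      ((scrollRight b).restrict fun w hw => (hN w hw).2)
  have h2 := LinearMap.finrank_range_add_finrank_ker Θ
  have h3 : Module.finrank k (LinearMap.range Θ) ≤ 4 := by
    refine (Submodule.finrank_le _).trans ?_
    rw [Module.finrank_prod, h.finrank_centerSpan]
  have h4 : Module.finrank k (LinearMap.ker Θ) ≤ v := by
    refine le_trans ?_ (finrank_vertexSpace b).le
    refine LinearMap.finrank_le_finrank_of_injective (f := ((N.subtype ∘ₗ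
      (LinearMap.ker Θ).subtype).codRestrict (vertexSpace b) ?_)) ?_
    · rintro ⟨⟨w, hw⟩, hΘ⟩
      rw [← ker_inf_ker_scroll b h.one_le_apply]
      rw [LinearMap.mem_ker] at hΘ
      have e1 := congrArg (fun x => (x.1 : _)) hΘ
      have e2 := congrArg (fun x => (x.2 : _)) hΘ
      exact ⟨congrArg Subtype.val e1, congrArg Subtype.val e2⟩
    · intro x y hxy
      have := congrArg Subtype.val hxy
      exact Subtype.ext (Subtype.ext this)
  omega

/-- The quadratic equation of the coordinate `ζ` along the centre. -/
lemma exists_quadratic (h : IsScrollProjection b π σ p ζ) :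
    ∃ F G : CoordPoly k r, ∀ w ∈ affineCone (scrollCone b),
      ζ w ^ 2 + MvPolynomial.eval (π w) F * ζ w + MvPolynomial.eval (π w) G = 0 := by
  obtain ⟨α, β, h1, h2, h3, h4⟩ := exists_dual_pair h.linearIndependent
  -- With `w = σ (π w) + ζ w • p`, the `(α, β)` minor becomes `(α A + ζ)(β B + ζ) - (α B)(β A)`,
  -- where `A`, `B` are the rows at `σ (π w)`; it is monic in `ζ`.
  refine ⟨linForm (α ∘ₗ scrollLeft b ∘ₗ σ) + linForm (β ∘ₗ scrollRight b ∘ₗ σ),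
    linForm (α ∘ₗ scrollLeft b ∘ₗ σ) * linForm (β ∘ₗ scrollRight b ∘ₗ σ) -
    linForm (α ∘ₗ scrollRight b ∘ₗ σ) * linForm (β ∘ₗ scrollLeft b ∘ₗ σ), fun w hw => ?_⟩
  have := mul_eq_mul_of_mem_affineCone h.one_le hw α β
  rw [h.eq_add w] at this
  simp only [map_add, map_smul, h1, h2, h3, h4, smul_eq_mul, mul_one, mul_zero, add_zero] at this
  simp only [map_add, map_sub, map_mul, eval_linForm, LinearMap.comp_apply]
  linear_combination this

lemma ringKrullDim_projImage (h : IsScrollProjection b π σ p ζ) :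
    ringKrullDim (coordRing (projImage π (scrollCone b))) =
      ringKrullDim (coordRing (scrollCone b)) := by
  obtain ⟨F, G, hFG⟩ := h.exists_quadratic
  exact AlmostMinimalDegree.ringKrullDim_projImage π h.not_le_ker h.eq_add hFG

/-- With two columns the scroll is a quadric hypersurface, cut out by a single minor. On the line
joining `p` to a lift of `y` this is a monic quadratic equation, which has a root. -/
lemma projImage_eq_univ [IsAlgClosed k] (h : IsScrollProjection b π σ p ζ)
    (hd : ∑ i, d i = 2) : projImage π (scrollCone b) = Set.univ := by
  obtain ⟨α, β, h1, h2, h3, h4⟩ := exists_dual_pair h.linearIndependent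
  have htop : centerSpan b p = ⊤ := by
    have := h.finrank_quotient
    rw [hd] at this
    have h0 : Module.finrank k (((Σ i : Fin l, Fin (d i)) → k) ⧸ centerSpan b p) = 0 := by omega
    rw [Module.finrank_zero_iff] at h0
    exact Submodule.Quotient.subsingleton_iff.1 h0
  have hext : ∀ u u' : (Σ i : Fin l, Fin (d i)) → k, α u = α u' → β u = β u' → u = u' := by
    intro u u' hα hβ
    have hu : u - u' ∈ centerSpan b p := htop ▸ Submodule.mem_top
    rw [centerSpan, Submodule.mem_span_pair] at hu
    obtain ⟨s, t, hst⟩ := hu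
    have e1 := congrArg α hst
    have e2 := congrArg β hst
    simp only [map_add, map_smul, h1, h2, h3, h4, map_sub, hα, hβ, sub_self, smul_eq_mul, mul_one,
      mul_zero, add_zero, zero_add] at e1 e2
    rw [e1, e2, zero_smul, zero_smul, zero_add] at hst
    exact sub_eq_zero.1 hst.symm
  refine Set.eq_univ_of_forall fun y => ?_
  let u := y.rep
  let P : Polynomial k := (Polynomial.X + Polynomial.C (α (scrollLeft b (σ u)))) *
    (Polynomial.X + Polynomial.C (β (scrollRight b (σ u)))) -
    Polynomial.C (α (scrollRight b (σ u)) * β (scrollLeft b (σ u)))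
  obtain ⟨τ, hτ⟩ := IsAlgClosed.exists_root P (by
    have : P.degree = 2 := by
      simp only [P]
      rw [Polynomial.degree_sub_eq_left_of_degree_lt] <;>
        rw [Polynomial.degree_mul, Polynomial.degree_X_add_C, Polynomial.degree_X_add_C]
      · norm_num
      · exact Polynomial.degree_C_le.trans_lt (by norm_num)
    rw [this]; norm_num)
  simp only [P, Polynomial.IsRoot.def, Polynomial.eval_sub, Polynomial.eval_mul,
    Polynomial.eval_add, Polynomial.eval_X, Polynomial.eval_C] at hτ
  let x := σ u + τ • p
  obtain ⟨q, hq, hqx⟩ := exists_ne_zero_mem_ker_of_mul_eq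
    (a := ![α (scrollLeft b x), β (scrollLeft b x)])
    (b := ![α (scrollRight b x), β (scrollRight b x)]) (by
      simp only [x, map_add, map_smul, Matrix.cons_val_zero, Matrix.cons_val_one, h1, h2, h3, h4,
        smul_eq_mul, mul_one, mul_zero, add_zero]
      linear_combination hτ)
  have hx : x ∈ rulingSpace b q := by
    rw [rulingSpace_eq_ker b hq, LinearMap.mem_ker, LinearMap.sub_apply, sub_eq_zero]
    apply hext
    · simpa using congrFun hqx 0
    · simpa using congrFun hqx 1
  have hπx : π x = u := by
    simp [x, h.map_section, h.map_center]
  have hx0 : x ≠ 0 := fun h0 => y.rep_nonzero (by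
    change u = 0
    rw [← hπx, h0, map_zero])
  refine ⟨Projectivization.mk k x hx0, ⟨q, hq, ?_⟩, ?_⟩
  · rwa [Projectivization.submodule_mk, Submodule.span_singleton_le_iff_mem]
  · rw [Projectivization.submodule_mk, Submodule.map_span, Set.image_singleton, hπx,
      Projectivization.submodule_eq]

end IsScrollProjection

end ScrollProjection

/-! ### The conductor of the projection and the depth bound. -/

section Conductor

variable {k : Type*} [Field k] {r l v : ℕ} {d : Fin l → ℕ}

lemma zero_mem_affineCone {X : Set (PSpace k r)} (hX : X.Nonempty) : 0 ∈ affineCone X := by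
  obtain ⟨x, hx⟩ := hX
  exact ⟨x, hx, Submodule.zero_mem _⟩

/-- Evaluation at the vertex of the affine cone. -/
def evalZero (X : Set (PSpace k r)) (hX : X.Nonempty) : coordRing X →+* k :=
  Ideal.Quotient.lift (projIdeal X) (MvPolynomial.eval 0) fun _ hF =>
    mem_projIdeal.1 hF 0 (zero_mem_affineCone hX)

lemma evalZero_mk (X : Set (PSpace k r)) (hX : X.Nonempty) (F : CoordPoly k r) :
    evalZero X hX (Ideal.Quotient.mk _ F) = MvPolynomial.eval 0 F := rfl

lemma smul_mem_affineCone {X : Set (PSpace k r)} {w : Fin (r + 1) → k} (hw : w ∈ affineCone X)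
    (t : k) : t • w ∈ affineCone X := by
  obtain ⟨x, hx, hxw⟩ := hw
  exact ⟨x, hx, x.submodule.smul_mem t hxw⟩

lemma ker_evalZero_le {X : Set (PSpace k r)} (hX : X.Nonempty) {I : Ideal (coordRing X)}
    (hI : ∀ f : Module.Dual k (Fin (r + 1) → k), Ideal.Quotient.mk (projIdeal X) (linForm f) ∈ I) :
    RingHom.ker (evalZero X hX) ≤ I := by
  intro a ha
  obtain ⟨F, rfl⟩ := Ideal.Quotient.mk_surjective a
  rw [RingHom.mem_ker, evalZero_mk] at ha
  have := sub_C_eval_zero_mem F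
  rw [ha, map_zero, sub_zero] at this
  rw [← Ideal.mem_comap]
  refine Ideal.span_le.2 ?_ this
  rintro _ ⟨i, rfl⟩
  rw [← linForm_proj]
  exact hI _

namespace IsScrollProjection

variable {b : Module.Basis ((Σ i : Fin l, Fin (d i + 1)) ⊕ Fin v) k (Fin (r + 1 + 1) → k)}
  {π : (Fin (r + 1 + 1) → k) →ₗ[k] (Fin (r + 1) → k)}
  {σ : (Fin (r + 1) → k) →ₗ[k] (Fin (r + 1 + 1) → k)} {p : Fin (r + 1 + 1) → k}
  {ζ : Module.Dual k (Fin (r + 1 + 1) → k)}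

/-- The linear forms vanishing on the vertex of the projected pencil multiply `ζ` into the
coordinate ring of the projection. -/
lemma exists_linForm_mul_eq (h : IsScrollProjection b π σ p ζ)
    {f : Module.Dual k (Fin (r + 1) → k)}
    (hf : f ∈ (LinearMap.ker (projLeft b σ p) ⊓ LinearMap.ker (projRight b σ p) :
      Submodule k _).dualAnnihilator) :
    ∃ G : CoordPoly k r, ∀ w ∈ affineCone (scrollCone b),
      f (π w) * ζ w = MvPolynomial.eval (π w) G := by
  -- A form vanishing on both kernels is a combination `φ'` of the first row plus a combination `ψ'`
  -- of the second.
  rw [Subspace.dualAnnihilator_inf_eq, ← LinearMap.range_dualMap_eq_dualAnnihilator_ker,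
    ← LinearMap.range_dualMap_eq_dualAnnihilator_ker, Submodule.mem_sup] at hf
  obtain ⟨_, ⟨φ', rfl⟩, _, ⟨ψ', rfl⟩, rfl⟩ := hf
  obtain ⟨α, β, h1, h2, h3, h4⟩ := exists_dual_pair h.linearIndependent
  have hvan : ∀ χ : Module.Dual k (((Σ i : Fin l, Fin (d i)) → k) ⧸ centerSpan b p),
      χ ((centerSpan b p).mkQ (scrollLeft b p)) = 0 ∧
      χ ((centerSpan b p).mkQ (scrollRight b p)) = 0 := by
    intro χ
    have e1 : (centerSpan b p).mkQ (scrollLeft b p) = 0 := by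
      rw [Submodule.mkQ_apply, Submodule.Quotient.mk_eq_zero]
      exact Submodule.subset_span (by simp)
    have e2 : (centerSpan b p).mkQ (scrollRight b p) = 0 := by
      rw [Submodule.mkQ_apply, Submodule.Quotient.mk_eq_zero]
      exact Submodule.subset_span (by simp)
    rw [e1, e2, map_zero]
    exact ⟨rfl, rfl⟩
  let φ := φ' ∘ₗ (centerSpan b p).mkQ
  let ψ := ψ' ∘ₗ (centerSpan b p).mkQ
  have hφA : φ (scrollLeft b p) = 0 := (hvan φ').1
  have hφB : φ (scrollRight b p) = 0 := (hvan φ').2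
  have hψA : ψ (scrollLeft b p) = 0 := (hvan ψ').1
  have hψB : ψ (scrollRight b p) = 0 := (hvan ψ').2
  let A (χ : Module.Dual k ((Σ i : Fin l, Fin (d i)) → k)) : CoordPoly k r :=
    linForm (χ ∘ₗ scrollLeft b ∘ₗ σ)
  let B (χ : Module.Dual k ((Σ i : Fin l, Fin (d i)) → k)) : CoordPoly k r :=
    linForm (χ ∘ₗ scrollRight b ∘ₗ σ)
  -- Since `φ` and `ψ` kill `centerSpan b p`, the `(φ, β)` and `(α, ψ)` minors are linear in `ζ`,
  -- with coefficients `A φ` and `B ψ`, whose sum is `f`.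
  refine ⟨(B φ * A β - A φ * B β) + (B α * A ψ - A α * B ψ), fun w hw => ?_⟩
  have e1 := mul_eq_mul_of_mem_affineCone h.one_le hw φ β
  have e2 := mul_eq_mul_of_mem_affineCone h.one_le hw α ψ
  rw [h.eq_add w] at e1 e2
  simp only [map_add, map_smul, h1, h2, h3, h4, hφA, hφB, hψA, hψB, smul_eq_mul, mul_one, mul_zero,
    add_zero] at e1 e2
  simp only [map_add, map_sub, map_mul, eval_linForm, LinearMap.comp_apply, A, B]
  rw [LinearMap.add_apply]
  change (φ (scrollLeft b (σ (π w))) + ψ (scrollRight b (σ (π w)))) * ζ w = _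
  linear_combination e1 + e2

/-- The coordinate `ζ` does not belong to the coordinate ring of the projection, even locally at
the vertex of the affine cone. -/
lemma not_forall_mul_eq [Infinite k] (h : IsScrollProjection b π σ p ζ) {F G : CoordPoly k r}
    (hF : MvPolynomial.eval 0 F ≠ 0) :
    ¬ ∀ w ∈ affineCone (scrollCone b),
      MvPolynomial.eval (π w) F * ζ w = MvPolynomial.eval (π w) G := by
  intro hFG
  obtain ⟨μ, hμ⟩ := exists_coeff_one_eq G
  -- Compare the coefficients of `t` along `t • w`. The resulting linear identity extends to the
  -- whole space because the scroll spans it, and at `p` it reads `F(0) = 0`.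
  have hlin : ∀ w ∈ affineCone (scrollCone b), MvPolynomial.eval 0 F * ζ w = μ (π w) := by
    intro w hw
    let PF : Polynomial k :=
      MvPolynomial.aeval (fun i => Polynomial.C (π w i) * Polynomial.X) F
    let PG : Polynomial k :=
      MvPolynomial.aeval (fun i => Polynomial.C (π w i) * Polynomial.X) G
    have hP : PF * (Polynomial.C (ζ w) * Polynomial.X) = PG := by
      apply Polynomial.funext
      intro t
      have := hFG _ (smul_mem_affineCone hw t)
      simp only [map_smul, smul_eq_mul] at this
      rw [Polynomial.eval_mul, eval_aeval, eval_aeval]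
      simp only [Polynomial.eval_mul, Polynomial.eval_C, Polynomial.eval_X]
      have e : (fun m => π w m * t) = t • π w := by
        ext m; simp [mul_comm]
      rw [e, ← this, mul_comm (ζ w)]
    have := congrArg (fun P => P.coeff 1) hP
    simp only [PG, hμ] at this
    rw [← this, ← mul_assoc, Polynomial.coeff_mul_X, Polynomial.coeff_mul_C]
    simp only [PF, coeff_zero_aeval]
  have hzero : MvPolynomial.eval 0 F • ζ - μ ∘ₗ π = 0 := by
    refine eq_zero_of_forall_affineCone_scrollCone b h.one_le fun w hw => ?_
    rw [LinearMap.sub_apply, LinearMap.smul_apply, smul_eq_mul, hlin w hw, LinearMap.comp_apply,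
      sub_self]
  have := LinearMap.congr_fun hzero p
  rw [LinearMap.sub_apply, LinearMap.smul_apply, smul_eq_mul, LinearMap.comp_apply, h.map_center,
    h.coord_center, map_zero, mul_one, sub_zero] at this
  exact hF this

theorem length_le_of_isRegular [Infinite k] (h : IsScrollProjection b π σ p ζ)
    {rs : List (CoordPoly k r)}
    (hrs : ∀ a ∈ rs, a ∈ Ideal.span (Set.range (MvPolynomial.X : Fin (r + 1) → CoordPoly k r)))
    (hreg : RingTheory.Sequence.IsRegular (coordRing (projImage π (scrollCone b))) rs) :
    rs.length ≤ v + 4 := by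
  set K := (LinearMap.ker (projLeft b σ p) ⊓ LinearMap.ker (projRight b σ p) : Submodule k _)
    with hK
  have hKv : Module.finrank k K ≤ v + 3 := h.finrank_vertex_le
  have hdom : IsDomain (coordRing (scrollCone b)) := isDomain_coordRing_scrollCone b h.one_le
  have hinj := coordMap_injective π h.not_le_ker
  have hdom' : IsDomain (coordRing (projImage π (scrollCone b))) := hinj.isDomain _
  have hne : (projImage π (scrollCone b)).Nonempty := by
    by_contra hempty
    rw [Set.not_nonempty_iff_eq_empty] at hempty
    have : projIdeal (projImage π (scrollCone b)) = ⊤ := by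
      rw [Ideal.eq_top_iff_one, mem_projIdeal, hempty]
      rintro x ⟨y, hy, -⟩
      exact hy.elim
    exact one_ne_zero (α := coordRing (projImage π (scrollCone b)))
      (by rw [← map_one (Ideal.Quotient.mk _), Ideal.Quotient.eq_zero_iff_mem, this]; trivial)
  let ev := evalZero _ hne
  have hprime : (RingHom.ker ev).IsPrime := RingHom.ker_isPrime _
  -- A basis of a complement of the annihilator of `K` gives the `dim K` generators needed beyond
  -- `J`.
  obtain ⟨C, hC⟩ : ∃ C : Subspace k (Module.Dual k (Fin (r + 1) → k)),
      IsCompl K.dualAnnihilator C := Submodule.exists_isCompl _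
  have hfree : Module.Free k C := Module.Free.of_divisionRing k C
  have hCn : Module.finrank k C = Module.finrank k K := by
    have e1 := Submodule.finrank_add_eq_of_isCompl hC
    have e2 := Subspace.finrank_add_finrank_dualAnnihilator_eq K
    rw [Subspace.dual_finrank_eq] at e1
    omega
  let y : Fin (Module.finrank k K) → coordRing (projImage π (scrollCone b)) := fun i =>
    Ideal.Quotient.mk _ (linForm (Module.finBasisOfFinrankEq k C hCn i : Module.Dual k _))
  let J : Ideal (coordRing (projImage π (scrollCone b))) :=
    Ideal.span ((fun f => Ideal.Quotient.mk _ (linForm f)) '' (K.dualAnnihilator : Set _))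
  have hker : RingHom.ker ev = J ⊔ Ideal.span (Set.range y) := by
    apply le_antisymm
    · refine ker_evalZero_le hne fun f => ?_
      obtain ⟨g, hg, c, hc, rfl⟩ := Submodule.mem_sup.1
        (hC.sup_eq_top ▸ Submodule.mem_top : f ∈ K.dualAnnihilator ⊔ C)
      rw [map_add, map_add]
      refine Submodule.add_mem_sup (Ideal.subset_span ⟨g, hg, rfl⟩) ?_
      have := (Module.finBasisOfFinrankEq k C hCn).sum_repr ⟨c, hc⟩
      have hc' : c = ∑ i, (Module.finBasisOfFinrankEq k C hCn).repr ⟨c, hc⟩ i •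
          (Module.finBasisOfFinrankEq k C hCn i : Module.Dual k _) :=
        (congrArg C.subtype this).symm.trans (by rw [map_sum]; rfl)
      rw [hc', map_sum, map_sum]
      refine Ideal.sum_mem _ fun i _ => ?_
      rw [map_smul, MvPolynomial.smul_eq_C_mul, map_mul]
      exact Ideal.mul_mem_left _ _ (Ideal.subset_span ⟨i, rfl⟩)
    · refine sup_le (Ideal.span_le.2 ?_) (Ideal.span_le.2 ?_)
      · rintro _ ⟨f, -, rfl⟩
        rw [SetLike.mem_coe, RingHom.mem_ker, evalZero_mk, eval_linForm, map_zero]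
      · rintro _ ⟨i, rfl⟩
        rw [SetLike.mem_coe, RingHom.mem_ker, evalZero_mk, eval_linForm, map_zero]
  have hmap : RingTheory.Sequence.IsWeaklyRegular (coordRing (projImage π (scrollCone b)))
      (rs.map (algebraMap (CoordPoly k r) (coordRing (projImage π (scrollCone b))))) :=
    (RingTheory.Sequence.isWeaklyRegular_map_algebraMap_iff _ _ _).2 hreg.toIsWeaklyRegular
  have hlen := length_le_of_conductor (coordMap π h.not_le_ker) hinj (RingHom.ker ev) J y hker
    (Ideal.Quotient.mk _ (linForm ζ)) ?_ ?_ (rs := rs.map (algebraMap _ _)) ?_ hmap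
  · rw [List.length_map] at hlen
    omega
  · intro a ha
    induction ha using Submodule.span_induction with
    | mem x hx =>
      obtain ⟨f, hf, rfl⟩ := hx
      obtain ⟨G, hG⟩ := h.exists_linForm_mul_eq hf
      refine ⟨Ideal.Quotient.mk _ G, ?_⟩
      rw [coordMap_mk, coordMap_mk, ← map_mul, mk_eq_mk_iff_forall]
      intro w hw
      rw [map_mul, eval_linPullback, eval_linPullback, eval_linForm, eval_linForm, hG w hw]
    | zero => exact ⟨0, by simp⟩
    | add x y _ _ hx hy =>
      obtain ⟨c, hc⟩ := hx
      obtain ⟨c', hc'⟩ := hy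
      exact ⟨c + c', by rw [map_add, map_add, add_mul, hc, hc']⟩
    | smul a x _ hx =>
      obtain ⟨c, hc⟩ := hx
      exact ⟨a * c, by rw [smul_eq_mul, map_mul, map_mul, mul_assoc, hc]⟩
  · intro s hs c hsc
    obtain ⟨F, rfl⟩ := Ideal.Quotient.mk_surjective s
    obtain ⟨G, rfl⟩ := Ideal.Quotient.mk_surjective c
    rw [RingHom.mem_ker, evalZero_mk] at hs
    refine h.not_forall_mul_eq (G := G) hs fun w hw => ?_
    rw [coordMap_mk, coordMap_mk, ← map_mul, mk_eq_mk_iff_forall] at hsc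
    have := hsc w hw
    rwa [map_mul, eval_linPullback, eval_linPullback, eval_linForm] at this
  · intro a ha
    obtain ⟨F, hF, rfl⟩ := List.mem_map.1 ha
    have hF' := hrs F hF
    rw [← Ideal.mem_comap]
    refine Ideal.span_le.2 ?_ hF'
    rintro _ ⟨i, rfl⟩
    rw [SetLike.mem_coe, Ideal.mem_comap, RingHom.mem_ker, Ideal.Quotient.algebraMap_eq,
      evalZero_mk, MvPolynomial.eval_X, Pi.zero_apply]

end IsScrollProjection

end Conductor

/-! ### Projective space has degree one. -/

section ProjectiveSpace

variable {k : Type*} [Field k] {r : ℕ}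

lemma finrank_homogeneousSubmodule (n : ℕ) :
    Module.finrank k (MvPolynomial.homogeneousSubmodule (Fin (r + 1)) k n) = (r + n).choose r := by
  have hset : {d : Fin (r + 1) →₀ ℕ | d.degree = n} =
      ((Finset.univ.finsuppAntidiag n : Finset (Fin (r + 1) →₀ ℕ)) : Set (Fin (r + 1) →₀ ℕ)) := by
    ext d
    simp [Finset.mem_finsuppAntidiag, Finsupp.degree_eq_sum]
  rw [MvPolynomial.homogeneousSubmodule_eq_finsupp_supported, hset]
  refine (Module.finrank_eq_nat_card_basis (MvPolynomial.basisRestrictSupport k _)).trans ?_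
  rw [Nat.card_eq_fintype_card]
  simp only [Finset.coe_sort_coe, Fintype.card_coe]
  rw [Finset.card_finsuppAntidiag_nat_eq_choose, Finset.card_univ, Fintype.card_fin,
    show r + 1 + n - 1 = r + n by omega, Nat.choose_symm_add]

lemma projIdeal_univ [Infinite k] : projIdeal (Set.univ : Set (PSpace k r)) = ⊥ := by
  rw [eq_bot_iff]
  intro F hF
  rw [mem_projIdeal] at hF
  refine MvPolynomial.funext fun x => ?_
  rw [map_zero]
  by_cases hx : x = 0
  · rw [hx]
    exact hF 0 (zero_mem_affineCone ⟨Projectivization.mk k (Pi.single 0 1) (by simp), trivial⟩)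
  · refine hF x ⟨Projectivization.mk k x hx, trivial, ?_⟩
    rw [Projectivization.submodule_mk]
    exact Submodule.mem_span_singleton_self x

lemma hilbertFn_univ [Infinite k] (n : ℕ) :
    hilbertFn (Set.univ : Set (PSpace k r)) n = (r + n).choose r := by
  rw [hilbertFn, ← finrank_homogeneousSubmodule (k := k)]
  refine (Submodule.equivMapOfInjective _ ?_ _).finrank_eq.symm
  intro F G hFG
  have := Ideal.Quotient.eq.1 hFG
  rwa [projIdeal_univ, Ideal.mem_bot, sub_eq_zero] at this

/-- The Hilbert polynomial is forced to be `(n + 1) ⋯ (n + r) / r!`, since it agrees with it for all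
large `n`. -/
lemma eq_one_of_hasDegree_univ [Infinite k] {e : ℤ} :
    HasDegree (Set.univ : Set (PSpace k r)) e → e = 1 := by
  rintro ⟨P, hP, he⟩
  let Q : Polynomial ℚ := Polynomial.C ((r.factorial : ℚ)⁻¹) *
    (ascPochhammer ℚ r).comp (Polynomial.X + Polynomial.C 1)
  have hQ : ∀ n : ℕ, Q.eval (n : ℚ) = ((r + n).choose r : ℕ) := by
    intro n
    have hr : (r.factorial : ℚ) ≠ 0 := Nat.cast_ne_zero.2 r.factorial_ne_zero
    have h1 : (ascPochhammer ℚ r).eval ((n : ℚ) + 1) = ((n + 1).ascFactorial r : ℕ) := by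
      rw [← ascPochhammer_nat_eq_ascFactorial, ascPochhammer_eval_cast, Nat.cast_succ]
    simp only [Q, Polynomial.eval_mul, Polynomial.eval_C, Polynomial.eval_comp,
      Polynomial.eval_add, Polynomial.eval_X]
    rw [h1, Nat.ascFactorial_eq_factorial_mul_choose, Nat.cast_mul, inv_mul_cancel_left₀ hr,
      add_comm n r]
  have hPQ : P = Q := by
    apply Polynomial.eq_of_infinite_eval_eq
    obtain ⟨N, hN⟩ := Filter.eventually_atTop.1 hP
    refine Set.Infinite.mono (s := (fun n : ℕ => (n : ℚ)) '' Set.Ici N) ?_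
      ((Set.Ici_infinite N).image (Nat.cast_injective.injOn))
    rintro _ ⟨n, hn, rfl⟩
    change P.eval (n : ℚ) = Q.eval (n : ℚ)
    rw [hN n hn, hQ, hilbertFn_univ]
  have hmonic : ((ascPochhammer ℚ r).comp (Polynomial.X + Polynomial.C 1)).Monic :=
    (monic_ascPochhammer ℚ r).comp_X_add_C 1
  have hdeg : ((ascPochhammer ℚ r).comp (Polynomial.X + Polynomial.C 1)).natDegree = r := by
    rw [Polynomial.natDegree_comp, ascPochhammer_natDegree, Polynomial.natDegree_X_add_C, mul_one]
  have hr : (r.factorial : ℚ)⁻¹ ≠ 0 := inv_ne_zero (Nat.cast_ne_zero.2 r.factorial_ne_zero)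
  rw [hPQ, Polynomial.natDegree_C_mul hr, hdeg, Polynomial.leadingCoeff_mul,
    Polynomial.leadingCoeff_C, hmonic.leadingCoeff, mul_one, mul_inv_cancel₀
      (Nat.cast_ne_zero.2 r.factorial_ne_zero)] at he
  exact_mod_cast he.symm

end ProjectiveSpace

/-! ### Choice of a section, and the theorem. -/

section Main

variable {k : Type*} [Field k]

lemma projDim_eq_of_ringKrullDim {r n : ℕ} {X : Set (PSpace k r)}
    (h : ringKrullDim (coordRing X) = (n + 1 : ℕ)) : projDim X = n := by
  rw [projDim, h]
  change ((((n + 1 : ℕ) : ℕ∞).toNat : ℕ) : ℤ) - 1 = n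
  rw [ENat.toNat_natCast]
  push_cast
  ring

lemma projDim_scrollCone [Infinite k] {r l v : ℕ} {d : Fin l → ℕ}
    (b : Module.Basis ((Σ i : Fin l, Fin (d i + 1)) ⊕ Fin v) k (Fin (r + 1) → k)) (hl : 1 ≤ l)
    (hd : ∀ i, 1 ≤ d i) : projDim (scrollCone b) = (l + v : ℕ) :=
  projDim_eq_of_ringKrullDim (ringKrullDim_coordRing_scrollCone b hl hd)

lemma exists_isScrollProjection {r l v : ℕ} {d : Fin l → ℕ}
    (b : Module.Basis ((Σ i : Fin l, Fin (d i + 1)) ⊕ Fin v) k (Fin (r + 1 + 1) → k))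
    (hl : 1 ≤ l) (hd : ∀ i, 1 ≤ d i) (p : PSpace k (r + 1)) (hp : p ∉ scrollCone b)
    (π : (Fin (r + 1 + 1) → k) →ₗ[k] (Fin (r + 1) → k)) (hπ : LinearMap.ker π = p.submodule) :
    ∃ σ ζ, IsScrollProjection b π σ p.rep ζ := by
  have hsurj : LinearMap.range π = ⊤ := by
    apply Submodule.eq_top_of_finrank_eq
    have := LinearMap.finrank_range_add_finrank_ker π
    rw [hπ, Projectivization.finrank_submodule] at this
    simp only [Module.finrank_fintype_fun_eq_card, Fintype.card_fin] at this ⊢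
    omega
  obtain ⟨σ, hσ⟩ := π.exists_rightInverse_of_surjective hsurj
  have hσ' : ∀ u, π (σ u) = u := fun u => LinearMap.congr_fun hσ u
  have hπp : π p.rep = 0 := by
    rw [← LinearMap.mem_ker, hπ, Projectivization.submodule_eq]
    exact Submodule.mem_span_singleton_self _
  obtain ⟨η, hη⟩ := Module.Projective.exists_dual_eq_one k p.rep_nonzero
  refine ⟨σ, η - η ∘ₗ σ ∘ₗ π, hl, hd, fun q hq hpq => hp ⟨q, hq, ?_⟩, hσ', hπp, fun w => ?_, ?_⟩
  · rwa [Projectivization.submodule_eq, Submodule.span_singleton_le_iff_mem]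
  · have hker : w - σ (π w) ∈ LinearMap.ker π := by
      rw [LinearMap.mem_ker, map_sub, hσ', sub_self]
    rw [hπ, Projectivization.submodule_eq, Submodule.mem_span_singleton] at hker
    obtain ⟨c, hc⟩ := hker
    have hζ : (η - η ∘ₗ σ ∘ₗ π) w = c := by
      have := congrArg η hc
      rw [map_smul, hη, smul_eq_mul, mul_one, map_sub] at this
      exact this.symm
    rw [hζ, hc]
    abel
  · simp [hπp, hη]

end Main

end AlmostMinimalDegree

end

theorem theorem1p4 {k : Type*} [Field k] [IsAlgClosed k] (r : ℕ) (h : ℤ)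
    (Xt : Set (AlmostMinimalDegree.PSpace k (r + 1)))
    (hXt : AlmostMinimalDegree.IsScrollCone Xt h)
    (p : AlmostMinimalDegree.PSpace k (r + 1)) (hp : p ∉ Xt)
    (π : (Fin (r + 1 + 1) → k) →ₗ[k] (Fin (r + 1) → k)) (hπ : LinearMap.ker π = p.submodule)
    (X : Set (AlmostMinimalDegree.PSpace k r))
    (hX : X = AlmostMinimalDegree.projImage π Xt) :
    ((AlmostMinimalDegree.projDim Xt < r ∨ AlmostMinimalDegree.IsAlmostMinimalDegree X) →
      ∃ (Y : Set (AlmostMinimalDegree.PSpace k r)) (l : ℤ),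
        AlmostMinimalDegree.IsScrollCone Y l ∧ X ⊆ Y ∧
        AlmostMinimalDegree.projDim Y = AlmostMinimalDegree.projDim Xt + 1 ∧
        AlmostMinimalDegree.projDim Y = AlmostMinimalDegree.projDim X + 1 ∧
        h ≤ l ∧ l ≤ h + 3) ∧
    (AlmostMinimalDegree.IsAlmostMinimalDegree X →
      ∃ t : ℕ, AlmostMinimalDegree.arithmeticDepth X = t ∧ (t : ℤ) ≤ h + 5) := by
  have : Infinite k := IsAlgClosed.instInfinite
  obtain ⟨l, v, d, b, hl, hd, rfl, rfl⟩ := hXt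
  subst hX
  obtain ⟨σ, ζ, hs⟩ := AlmostMinimalDegree.exists_isScrollProjection b hl hd p hp π hπ
  rw [AlmostMinimalDegree.finrank_vertexSpace]
  have hdimXt := AlmostMinimalDegree.projDim_scrollCone b hl hd
  have hdimX : AlmostMinimalDegree.projDim (AlmostMinimalDegree.projImage π
      (AlmostMinimalDegree.scrollCone b)) = (l + v : ℕ) :=
    AlmostMinimalDegree.projDim_eq_of_ringKrullDim (hs.ringKrullDim_projImage.trans
      (AlmostMinimalDegree.ringKrullDim_coordRing_scrollCone b hl hd))
  have hamb := hs.finrank_ambient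
  have hquot := hs.finrank_quotient
  refine ⟨fun hcase => ?_, fun _ => ?_⟩
  -- This makes the target of the projected pencil nonzero. If the sum were `2`, then `l + v = r`:
  -- the scroll would be a hypersurface and `X` all of `ℙ^r`, of degree `1` instead of `2`.
  · have hD : 3 ≤ ∑ i, d i := by
      by_contra hD
      have hD2 : ∑ i, d i = 2 := by omega
      rcases hcase with hlt | hamd
      · rw [hdimXt] at hlt
        have : l + v < r := by exact_mod_cast hlt
        omega
      · have hdeg := hamd.2.2
        rw [hdimX, hs.projImage_eq_univ hD2] at hdeg
        have h1 := AlmostMinimalDegree.eq_one_of_hasDegree_univ hdeg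
        push_cast at h1
        omega
    have hnontriv : Nontrivial (((Σ i : Fin l, Fin (d i)) → k) ⧸
        AlmostMinimalDegree.centerSpan b p.rep) :=
      Module.nontrivial_of_finrank_pos (R := k) (by omega)
    obtain ⟨l', v', d', b', hl', hd', hY, hK, hdim⟩ := hs.pencilSurjective.exists_scrollBasis
    have hv1 := hs.le_finrank_vertex
    have hv2 := hs.finrank_vertex_le
    rw [hK, AlmostMinimalDegree.finrank_vertexSpace] at hv1 hv2
    have hdimY := AlmostMinimalDegree.projDim_scrollCone b' hl' hd'
    -- Now `r + 1 = (D - 2) + l' + v'`; compared with `r + 2 = D + l + v` this gives `l' + v' = l +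
    -- v + 1`.
    rw [Module.finrank_fintype_fun_eq_card, Fintype.card_fin] at hdim
    refine ⟨AlmostMinimalDegree.scrollCone b', (v' : ℤ) - 1, ⟨l', v', d', b', hl', hd', rfl, ?_⟩,
      ?_, ?_, ?_, ?_, ?_⟩
    · rw [AlmostMinimalDegree.finrank_vertexSpace]
    · rw [← hY]
      exact hs.projImage_subset
    · rw [hdimY, hdimXt]
      norm_cast
      omega
    · rw [hdimY, hdimX]
      norm_cast
      omega
    · omega
    · omega
  · have hle : AlmostMinimalDegree.arithmeticDepth (AlmostMinimalDegree.projImage π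
        (AlmostMinimalDegree.scrollCone b)) ≤ ((v + 4 : ℕ) : ℕ∞) := by
      refine iSup_le fun rs => ?_
      exact_mod_cast hs.length_le_of_isRegular rs.2.1 rs.2.2
    -- The bound makes the supremum finite; with `h = v - 1` it is `h + 5`.
    obtain ⟨t, ht⟩ := ENat.ne_top_iff_exists.1 (ne_top_of_le_ne_top (ENat.natCast_ne_top _) hle)
    refine ⟨t, ht.symm, ?_⟩
    rw [← ht] at hle
    have : t ≤ v + 4 := by exact_mod_cast hle
    omega
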